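/- Let $\mathcal{O}=\mathbb{C}\{x,y\}$ be the ring of germs at $0\in\mathbb{C}^2$ of holomorphic functions. Let $\mathcal{W}(4)$ be a nonsingular $4$-web of $(\mathbb{C}^2,0)$, i.e. the foliations by level curves of germs $F_1,\dots,F_4\in\mathcal{O}$ with $F_i(0)=0$ and $dF_i(0)\wedge dF_j(0)\neq 0$ for $i\ne j$. Its rank is $\operatorname{rg}\mathcal{W}(4)=\dim_{\mathbb{C}}\{(g_i(F_i))_i\in\mathcal{O}^4 : g_i\in\mathbb{C}\{t\},\ \sum_i g_i(F_i)\,dF_i=0\}$. The Blaschke curvature of a nonsingular $3$-web defined by $F_1,F_2,F_3$ is the $2$-form $d\gamma$, where $\gamma$ is a $1$-form with $d\omega_i=\gamma\wedge\omega_i$ for $i=1,2,3$, and $\omega_i=\rho_i\,dF_i$ with units $\rho_i\in\mathcal{O}^*$ such that $\omega_1+\omega_2+\omega_3=0$. (1) If the Blaschke curvatures of the four $3$-webs extracted from $\mathcal{W}(4)$ are all equal to one $2$-form whose germ at $0$ is not zero, then $\operatorname{rg}\mathcal{W}(4)\le 1$. (2) Suppose that $\mathcal{W}(4)$ is presented by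 a differential equation $F(x,y,y')=a_0(y')^4+a_1(y')^3+\dots+a_4=0$ with $a_i\in\mathcal{O}$: the slopes $p_i=-\partial_x(F_i)/\partial_y(F_i)$ belong to $\mathcal{O}$ and are roots of $F(x,y,p)\in\mathcal{O}[p]$, which has degree $4$ and whose $p$-resultant with $\partial_pF$ does not vanish at $0$. The condition that the $1$-form $(b_3p+b_4)\,\dfrac{dy-p\,dx}{\partial_p F}$ on the surface $\{F(x,y,p)=0\}$ be closed is a linear system $$\partial_x b_4+A_{11}b_3+A_{12}b_4=0,\quad \partial_x b_3+\partial_y b_4+A_{21}b_3+A_{22}b_4=0,\quad \partial_y b_3+A_{31}b_3+A_{32}b_4=0$$ with $A_{ij}\in\mathcal{O}$. Let $E\subset J_2(\mathcal{O}^2)$ be the rank $3$ bundle of $2$-jets satisfying this system and its first order derivatives, with the connection $\nabla:E\to\Omega^1\otimes E$ given by $(\nabla_{x}s)_\alpha=\partial_x s_\alpha-s_{\alpha+(1,0)}$ and $(\nabla_{y}s)_\alpha=\partial_y s_\alpha-s_{\alpha+(0,1)}$ for the components $\alpha$ of order $|\alpha|\le 1$ (these determine a section of $E$). If the Blaschke–Chern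 curvature of $\mathcal{W}(4)$, i.e. the trace of the curvature of $(E,\nabla)$, is zero, then $\operatorname{rg}\mathcal{W}(4)\neq 2$. -/

import Mathlib

open Filter Topology Polynomial

noncomputable section

namespace PlaneWeb

/-! ### The ring `𝒪 = ℂ{x, y}` of germs at `0 ∈ ℂ²` of holomorphic functions -/

/-- Germs at the origin of `ℂ²` of holomorphic functions, as a subring of all germs of functions. -/
def holSubring : Subring (Germ (𝓝 (0 : ℂ × ℂ)) ℂ) where
  carrier := {φ | ∃ f : ℂ × ℂ → ℂ, AnalyticAt ℂ f 0 ∧ (f : Germ (𝓝 (0 : ℂ × ℂ)) ℂ) = φ}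
  mul_mem' := by
    rintro _ _ ⟨f, hf, rfl⟩ ⟨g, hg, rfl⟩
    exact ⟨f * g, hf.mul hg, rfl⟩
  one_mem' := ⟨fun _ => 1, analyticAt_const, rfl⟩
  add_mem' := by
    rintro _ _ ⟨f, hf, rfl⟩ ⟨g, hg, rfl⟩
    exact ⟨f + g, hf.add hg, rfl⟩
  zero_mem' := ⟨fun _ => 0, analyticAt_const, rfl⟩
  neg_mem' := by
    rintro _ ⟨f, hf, rfl⟩
    exact ⟨-f, hf.neg, rfl⟩

/-- The ring `𝒪 = ℂ{x, y}`. -/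
abbrev Hol : Type := holSubring

/-- The germ of a function that is holomorphic near the origin. -/
def Hol.mk (f : ℂ × ℂ → ℂ) (hf : AnalyticAt ℂ f 0) : Hol := ⟨f, f, hf, rfl⟩

/-- Constant germs. -/
def Hol.const : ℂ →+* Hol where
  toFun c := Hol.mk (fun _ => c) analyticAt_const
  map_one' := rfl
  map_mul' _ _ := rfl
  map_zero' := rfl
  map_add' _ _ := rfl

instance : Algebra ℂ Hol := Hol.const.toAlgebra

/-- The value of a germ at the origin. -/
def Hol.value (φ : Hol) : ℂ := Germ.value (φ : Germ (𝓝 (0 : ℂ × ℂ)) ℂ)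

/-- A holomorphic representative of a germ. -/
def Hol.rep (φ : Hol) : ℂ × ℂ → ℂ := φ.2.choose

theorem Hol.rep_analyticAt (φ : Hol) : AnalyticAt ℂ φ.rep 0 := φ.2.choose_spec.1

theorem Hol.mk_rep (φ : Hol) : Hol.mk φ.rep φ.rep_analyticAt = φ :=
  Subtype.ext φ.2.choose_spec.2

theorem Hol.mk_eq_mk {f g : ℂ × ℂ → ℂ} {hf : AnalyticAt ℂ f 0} {hg : AnalyticAt ℂ g 0} :
    Hol.mk f hf = Hol.mk g hg ↔ f =ᶠ[𝓝 0] g :=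
  Subtype.ext_iff.trans Germ.coe_eq

theorem Hol.ind {p : Hol → Prop} (h : ∀ f hf, p (Hol.mk f hf)) (φ : Hol) : p φ := by
  rw [← φ.mk_rep]; exact h _ _

theorem analyticAt_fderiv_apply {f : ℂ × ℂ → ℂ} (hf : AnalyticAt ℂ f 0) (v : ℂ × ℂ) :
    AnalyticAt ℂ (fun z => fderiv ℂ f z v) 0 :=
  ((ContinuousLinearMap.apply ℂ ℂ v).analyticAt _).comp hf.fderiv

/-- The derivative of a germ in the direction `v`, as a function on germs. -/
def dirFun (v : ℂ × ℂ) (φ : Hol) : Hol :=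
  Hol.mk (fun z => fderiv ℂ φ.rep z v) (analyticAt_fderiv_apply φ.rep_analyticAt v)

theorem dirFun_mk (v : ℂ × ℂ) (f : ℂ × ℂ → ℂ) (hf : AnalyticAt ℂ f 0) :
    dirFun v (Hol.mk f hf) =
      Hol.mk (fun z => fderiv ℂ f z v) (analyticAt_fderiv_apply hf v) := by
  refine Hol.mk_eq_mk.2 ?_
  have h : (Hol.mk f hf).rep =ᶠ[𝓝 0] f := Hol.mk_eq_mk.1 (Hol.mk_rep _)
  filter_upwards [h.fderiv (𝕜 := ℂ)] with z hz
  rw [hz]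

/-- The derivation of `𝒪` given by the derivative in the direction `v`. -/
def dir (v : ℂ × ℂ) : Derivation ℂ Hol Hol where
  toFun := dirFun v
  map_add' φ ψ := by
    induction φ using Hol.ind with | _ f hf
    induction ψ using Hol.ind with | _ g hg
    have h : Hol.mk f hf + Hol.mk g hg = Hol.mk (f + g) (hf.add hg) := rfl
    rw [h, dirFun_mk, dirFun_mk, dirFun_mk]
    refine Subtype.ext (Germ.coe_eq.2 ?_)
    filter_upwards [hf.eventually_analyticAt, hg.eventually_analyticAt] with z h1 h2
    rw [fderiv_add h1.differentiableAt h2.differentiableAt]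
    rfl
  map_smul' c φ := by
    induction φ using Hol.ind with | _ f hf
    have h : c • Hol.mk f hf = Hol.mk (c • f) (analyticAt_const.smul hf) := rfl
    have h' : ∀ (g : ℂ × ℂ → ℂ) (hg : AnalyticAt ℂ g 0),
      (RingHom.id ℂ) c • Hol.mk g hg = Hol.mk (c • g) (analyticAt_const.smul hg) :=
      fun _ _ => rfl
    rw [h, dirFun_mk, dirFun_mk, h']
    refine Hol.mk_eq_mk.2 ?_
    filter_upwards [hf.eventually_analyticAt] with z h1
    rw [fderiv_const_smul h1.differentiableAt]
    rfl
  map_one_eq_zero' := by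
    change dirFun v (Hol.mk (fun _ => 1) analyticAt_const) = Hol.mk (fun _ => 0) analyticAt_const
    rw [dirFun_mk]
    refine Hol.mk_eq_mk.2 (Eventually.of_forall fun z => ?_)
    simp
  leibniz' φ ψ := by
    change dirFun v (φ * ψ) = φ * dirFun v ψ + ψ * dirFun v φ
    induction φ using Hol.ind with | _ f hf
    induction ψ using Hol.ind with | _ g hg
    have h : Hol.mk f hf * Hol.mk g hg = Hol.mk (f * g) (hf.mul hg) := rfl
    rw [h, dirFun_mk, dirFun_mk, dirFun_mk]
    refine Subtype.ext (Germ.coe_eq.2 ?_)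
    filter_upwards [hf.eventually_analyticAt, hg.eventually_analyticAt] with z h1 h2
    rw [fderiv_mul h1.differentiableAt h2.differentiableAt]
    rfl

theorem dir_mk (v : ℂ × ℂ) (f : ℂ × ℂ → ℂ) (hf : AnalyticAt ℂ f 0) :
    dir v (Hol.mk f hf) = Hol.mk (fun z => fderiv ℂ f z v) (analyticAt_fderiv_apply hf v) :=
  dirFun_mk v f hf

theorem dir_comm (v w : ℂ × ℂ) (φ : Hol) : dir v (dir w φ) = dir w (dir v φ) := by
  induction φ using Hol.ind with | _ f hf
  rw [dir_mk, dir_mk, dir_mk, dir_mk]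
  refine Hol.mk_eq_mk.2 ?_
  filter_upwards [hf.eventually_analyticAt] with z hz
  have hd : DifferentiableAt ℂ (fderiv ℂ f) z := hz.fderiv.differentiableAt
  have hs : IsSymmSndFDerivAt ℂ f z := hz.contDiffAt.isSymmSndFDerivAt_of_omega
  have key : ∀ a b : ℂ × ℂ, fderiv ℂ (fun y => fderiv ℂ f y a) z b
      = fderiv ℂ (fderiv ℂ f) z b a := by
    intro a b
    rw [fderiv_clm_apply hd (differentiableAt_const a)]
    simp
  rw [key, key]
  exact hs v w

/-- `∂/∂x` on `𝒪`. -/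
def dx : Derivation ℂ Hol Hol := dir (1, 0)

/-- `∂/∂y` on `𝒪`. -/
def dy : Derivation ℂ Hol Hol := dir (0, 1)

theorem dx_dy (φ : Hol) : dx (dy φ) = dy (dx φ) := dir_comm _ _ φ

/-! ### Differential forms: the pair `(a, b)` is the 1-form `a dx + b dy`, and a germ `c` stands for
the 2-form `c dx ∧ dy` -/

/-- Germs of holomorphic 1-forms `a dx + b dy`. -/
abbrev OneForm : Type := Hol × Hol

/-- The differential of a germ. -/
def dFun (φ : Hol) : OneForm := (dx φ, dy φ)

/-- The coefficient of `dx ∧ dy` in the wedge product of two 1-forms. -/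
def wedge (α β : OneForm) : Hol := α.1 * β.2 - α.2 * β.1

/-- The coefficient of `dx ∧ dy` in the exterior derivative of a 1-form. -/
def dForm (α : OneForm) : Hol := dx α.2 - dy α.1

/-! ### Nonsingular webs, abelian relations, rank, Blaschke curvature -/

/-- A nonsingular `d`-web of `(ℂ², 0)`: the leaves are the level curves of germs `F i ∈ 𝒪` with
`F i (0) = 0` and `dF i (0) ∧ dF j (0) ≠ 0` for `i ≠ j`. -/
structure Web (d : ℕ) where
  /-- The germs whose level curves are the leaves. -/
  F : Fin d → Hol
  F_zero : ∀ i, (F i).value = 0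
  general_position : ∀ i j, i ≠ j → (wedge (dFun (F i)) (dFun (F j))).value ≠ 0

/-- The complex vector space `𝒜(d)` of abelian relations of a web: families `(g i (F i))` in `𝒪^d`
with `g i ∈ ℂ{t}` and `∑ g i (F i) dF i = 0`. -/
def Web.abelianRelations {d : ℕ} (W : Web d) : Submodule ℂ (Fin d → Hol) where
  carrier := {G |
    (∀ i, ∃ g : ℂ → ℂ, AnalyticAt ℂ g 0 ∧
      (G i : Germ (𝓝 (0 : ℂ × ℂ)) ℂ) = Germ.map g (W.F i : Germ (𝓝 (0 : ℂ × ℂ)) ℂ)) ∧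
    ∑ i, G i • dFun (W.F i) = 0}
  add_mem' := by
    rintro G H ⟨hG, hG'⟩ ⟨hH, hH'⟩
    refine ⟨fun i => ?_, ?_⟩
    · obtain ⟨g, hg, e⟩ := hG i
      obtain ⟨h, hh, e'⟩ := hH i
      refine ⟨g + h, hg.add hh, ?_⟩
      change (G i : Germ (𝓝 (0 : ℂ × ℂ)) ℂ) + (H i : Germ (𝓝 (0 : ℂ × ℂ)) ℂ) = _
      rw [e, e']
      exact Germ.inductionOn (W.F i : Germ (𝓝 (0 : ℂ × ℂ)) ℂ) fun f => rfl
    · simp only [Pi.add_apply, add_smul, Finset.sum_add_distrib, hG', hH', add_zero]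
  zero_mem' := by
    refine ⟨fun i => ⟨fun _ => 0, analyticAt_const, ?_⟩, by simp⟩
    exact Germ.inductionOn (W.F i : Germ (𝓝 (0 : ℂ × ℂ)) ℂ) fun f => rfl
  smul_mem' := by
    rintro c G ⟨hG, hG'⟩
    refine ⟨fun i => ?_, ?_⟩
    · obtain ⟨g, hg, e⟩ := hG i
      refine ⟨fun t => c * g t, analyticAt_const.mul hg, ?_⟩
      change ((fun _ => c : ℂ × ℂ → ℂ) : Germ (𝓝 (0 : ℂ × ℂ)) ℂ) *
        (G i : Germ (𝓝 (0 : ℂ × ℂ)) ℂ) = _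
      rw [e]
      exact Germ.inductionOn (W.F i : Germ (𝓝 (0 : ℂ × ℂ)) ℂ) fun f => rfl
    · have : ∑ i, (c • G) i • dFun (W.F i) = c • ∑ i, G i • dFun (W.F i) := by
        rw [Finset.smul_sum]
        exact Finset.sum_congr rfl fun i _ => smul_assoc c (G i) (dFun (W.F i))
      rw [this, hG', smul_zero]

/-- The rank of a web: the dimension over `ℂ` of its space of abelian relations (a cardinal). -/
def Web.rank {d : ℕ} (W : Web d) : Cardinal := Module.rank ℂ W.abelianRelations

/-- The 3-web extracted from a 4-web by removing the `k`-th foliation. -/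
def Web.extract (W : Web 4) (k : Fin 4) : Web 3 where
  F i := W.F (k.succAbove i)
  F_zero _ := W.F_zero _
  general_position _ _ h := W.general_position _ _ (fun e => h (Fin.succAbove_right_injective e))

/-- `K dx ∧ dy` is the Blaschke curvature of the 3-web `W`: there are units `ρ i` of `𝒪` such that
the 1-forms `ω i = ρ i dF i` have sum `0`, and a 1-form `γ` with `dω i = γ ∧ ω i` for all `i` and
`dγ = K dx ∧ dy`. -/
def Web.IsBlaschkeCurvature (W : Web 3) (K : Hol) : Prop :=
  ∃ (ρ : Fin 3 → Hol) (γ : OneForm),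
    (∀ i, IsUnit (ρ i)) ∧
    ∑ i, ρ i • dFun (W.F i) = 0 ∧
    (∀ i, dForm (ρ i • dFun (W.F i)) = wedge γ (ρ i • dFun (W.F i))) ∧
    dForm γ = K

/-! ### Presentation of a 4-web by a differential equation `P(x, y, y') = 0` -/

/-- The slope `p i = - ∂ₓ(F i) / ∂_y(F i)` of the leaves of the `i`-th foliation (a germ of `𝒪` as
soon as `∂_y(F i)` is a unit). -/
def Web.slope {d : ℕ} (W : Web d) (i : Fin d) : Hol :=
  -(dx (W.F i) * Ring.inverse (dy (W.F i)))

/-- `P ∈ 𝒪[p]` presents the web `W` implicitly: `P` has degree `d`, the leaves of `W` have slopes in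
`𝒪`, these are roots of `P`, and the `p`-resultant of `P` and `∂_p P` does not vanish at the
origin. -/
structure Web.IsPresentedBy {d : ℕ} (W : Web d) (P : Hol[X]) : Prop where
  natDegree_eq : P.natDegree = d
  isUnit_dy : ∀ i, IsUnit (dy (W.F i))
  isRoot : ∀ i, P.IsRoot (W.slope i)
  resultant_ne : (P.resultant (derivative P)).value ≠ 0

/-! ### The differential system `ℳ(4)` of a presented 4-web

On the sheet `p = p i` of the surface `S = {P = 0}` the form
`(b₃ p + b₄) (dy - p dx) / ∂_p P` is `r (dy - p dx)` with `r = (b₃ p + b₄) / ∂_p P`, and it is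
closed iff `∂ₓ r + ∂_y (p r) = 0`. Multiplied by `∂_p P` this reads, on all sheets,
`∂ₓ b₄ + p (∂ₓ b₃ + ∂_y b₄) + p² ∂_y b₃ + b₃ c₃ + b₄ c₄ = 0`, with `c₃`, `c₄` given by
`closednessTerm` below. Interpolating `c₃`, `c₄` at the four slopes by polynomials in `p` and
comparing the coefficients of `1`, `p`, `p²` gives `ℳ(4)`. -/

/-- `q i = ∂_p P (x, y, p i)`. -/
def Web.sheetDeriv (W : Web 4) (P : Hol[X]) (i : Fin 4) : Hol := (derivative P).eval (W.slope i)

/-- `q (∂ₓ (p ^ m / q) + ∂_y (p ^ (m + 1) / q))` on the sheet `p = p i`, where `q = ∂_p P`;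
the exponent is `m = 1` for the unknown `b₃` (index `0`) and `m = 0` for `b₄` (index `1`). -/
def Web.closednessTerm (W : Web 4) (P : Hol[X]) (i : Fin 4) (l : Fin 2) : Hol :=
  W.sheetDeriv P i *
    (dx (W.slope i ^ (1 - (l : ℕ)) * Ring.inverse (W.sheetDeriv P i)) +
      dy (W.slope i ^ (1 - (l : ℕ) + 1) * Ring.inverse (W.sheetDeriv P i)))

/-- The coefficients of the system `ℳ(4)`: row `j` is the coefficient of `p ^ j` in the interpolation
polynomial, column `0` belongs to `b₃` and column `1` to `b₄`. (The coefficient of `p ^ 3` is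
zero.) -/
def Web.systemCoeff (W : Web 4) (P : Hol[X]) (j : Fin 3) (l : Fin 2) : Hol :=
  ((Matrix.vandermonde W.slope)⁻¹ * Matrix.of (W.closednessTerm P)) j.castSucc l

/-! ### The bundle `E` of formal solutions and its connection

For any matrix `A` of germs we consider the system
* `∂ₓ b₁ + A₀₀ b₀ + A₀₁ b₁ = 0`
* `∂ₓ b₀ + ∂_y b₁ + A₁₀ b₀ + A₁₁ b₁ = 0`
* `∂_y b₀ + A₂₀ b₀ + A₂₁ b₁ = 0`

in the unknown germs `(b₀, b₁)` (these are `(b₃, b₄)` for `ℳ(4)`), and its first prolongation. -/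

/-- Multi-indices of order at most 2 in `(x, y)`. -/
inductive MIdx
  | o | x | y | xx | xy | yy

/-- Sections of the bundle `J₂(𝒪²)` of 2-jets of pairs of germs; `s l α` is the formal derivative of
index `α` of the `l`-th unknown. -/
abbrev Jet : Type := Fin 2 → MIdx → Hol

/-- The term `A_{j0} b₀ + A_{j1} b₁` of the `j`-th equation. -/
def eqO (A : Fin 3 → Fin 2 → Hol) (j : Fin 3) (s : Jet) : Hol := ∑ l, A j l * s l .o

/-- Formal `x`-derivative of `eqO`. -/
def eqX (A : Fin 3 → Fin 2 → Hol) (j : Fin 3) (s : Jet) : Hol :=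
  ∑ l, (dx (A j l) * s l .o + A j l * s l .x)

/-- Formal `y`-derivative of `eqO`. -/
def eqY (A : Fin 3 → Fin 2 → Hol) (j : Fin 3) (s : Jet) : Hol :=
  ∑ l, (dy (A j l) * s l .o + A j l * s l .y)

/-- Membership in `E ⊂ J₂(𝒪²)`: the three equations of the system and their formal derivatives with
respect to `x` and to `y`. -/
structure IsFormalSolution (A : Fin 3 → Fin 2 → Hol) (s : Jet) : Prop where
  o0 : s 1 .x + eqO A 0 s = 0
  o1 : s 0 .x + s 1 .y + eqO A 1 s = 0
  o2 : s 0 .y + eqO A 2 s = 0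
  x0 : s 1 .xx + eqX A 0 s = 0
  x1 : s 0 .xx + s 1 .xy + eqX A 1 s = 0
  x2 : s 0 .xy + eqX A 2 s = 0
  y0 : s 1 .xy + eqY A 0 s = 0
  y1 : s 0 .xy + s 1 .yy + eqY A 1 s = 0
  y2 : s 0 .yy + eqY A 2 s = 0

theorem IsFormalSolution.zero (A : Fin 3 → Fin 2 → Hol) : IsFormalSolution A 0 := by
  constructor <;> simp [eqO, eqX, eqY]

theorem IsFormalSolution.add {A : Fin 3 → Fin 2 → Hol} {s t : Jet} (hs : IsFormalSolution A s)
    (ht : IsFormalSolution A t) : IsFormalSolution A (s + t) := by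
  obtain ⟨a0, a1, a2, a3, a4, a5, a6, a7, a8⟩ := hs
  obtain ⟨b0, b1, b2, b3, b4, b5, b6, b7, b8⟩ := ht
  simp only [eqO, eqX, eqY, Fin.sum_univ_two] at *
  constructor <;> simp only [eqO, eqX, eqY, Fin.sum_univ_two, Pi.add_apply]
  · linear_combination a0 + b0
  · linear_combination a1 + b1
  · linear_combination a2 + b2
  · linear_combination a3 + b3
  · linear_combination a4 + b4
  · linear_combination a5 + b5
  · linear_combination a6 + b6
  · linear_combination a7 + b7
  · linear_combination a8 + b8

theorem IsFormalSolution.smul {A : Fin 3 → Fin 2 → Hol} {s : Jet} (c : Hol)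
    (hs : IsFormalSolution A s) : IsFormalSolution A (c • s) := by
  obtain ⟨a0, a1, a2, a3, a4, a5, a6, a7, a8⟩ := hs
  simp only [eqO, eqX, eqY, Fin.sum_univ_two] at *
  constructor <;> simp only [eqO, eqX, eqY, Fin.sum_univ_two, Pi.smul_apply, smul_eq_mul]
  · linear_combination c * a0
  · linear_combination c * a1
  · linear_combination c * a2
  · linear_combination c * a3
  · linear_combination c * a4
  · linear_combination c * a5
  · linear_combination c * a6
  · linear_combination c * a7
  · linear_combination c * a8

/-- The `𝒪`-module of sections of the bundle `E ⊂ J₂(𝒪²)`. -/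
def bundle (A : Fin 3 → Fin 2 → Hol) : Submodule Hol Jet where
  carrier := {s | IsFormalSolution A s}
  add_mem' := IsFormalSolution.add
  zero_mem' := IsFormalSolution.zero A
  smul_mem' c _ := IsFormalSolution.smul c

/-- The jet determined by `b₀ = u`, `b₁ = v`, `∂ₓ b₀ = w` and the equations. -/
def jetOf (A : Fin 3 → Fin 2 → Hol) (u v w : Hol) : Jet :=
  let e (j : Fin 3) : Hol := A j 0 * u + A j 1 * v
  let ex (j : Fin 3) : Hol := dx (A j 0) * u + A j 0 * w + (dx (A j 1) * v + A j 1 * (-e 0))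
  let ey (j : Fin 3) : Hol :=
    dy (A j 0) * u + A j 0 * (-e 2) + (dy (A j 1) * v + A j 1 * (-w - e 1))
  ![fun | .o => u | .x => w | .y => -e 2 | .xx => ey 0 - ex 1 | .xy => -ex 2 | .yy => -ey 2,
    fun | .o => v | .x => -e 0 | .y => -w - e 1 | .xx => -ex 0 | .xy => -ey 0 | .yy => ex 2 - ey 1]

theorem jetOf_mem (A : Fin 3 → Fin 2 → Hol) (u v w : Hol) : jetOf A u v w ∈ bundle A := by
  change IsFormalSolution A _
  constructor <;> simp [eqO, eqX, eqY, jetOf, Fin.sum_univ_two] <;> ring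

theorem eq_jetOf {A : Fin 3 → Fin 2 → Hol} {s : Jet} (hs : s ∈ bundle A) :
    s = jetOf A (s 0 .o) (s 1 .o) (s 0 .x) := by
  obtain ⟨a0, a1, a2, a3, a4, a5, a6, a7, a8⟩ := (hs : IsFormalSolution A s)
  simp only [eqO, eqX, eqY, Fin.sum_univ_two] at *
  have c0 : s 1 .x = -(A 0 0 * s 0 .o + A 0 1 * s 1 .o) := by linear_combination a0
  have c1 : s 1 .y = -s 0 .x - (A 1 0 * s 0 .o + A 1 1 * s 1 .o) := by linear_combination a1
  have c2 : s 0 .y = -(A 2 0 * s 0 .o + A 2 1 * s 1 .o) := by linear_combination a2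
  rw [c0] at a3 a4 a5
  rw [c1, c2] at a6 a7 a8
  funext l α
  fin_cases l <;> cases α <;> simp only [jetOf, Fin.zero_eta, Fin.mk_one, Matrix.cons_val_zero,
    Matrix.cons_val_one]
  · linear_combination c2
  · linear_combination a4 - a6
  · linear_combination a5
  · linear_combination a8
  · linear_combination c0
  · linear_combination c1
  · linear_combination a3
  · linear_combination a6
  · linear_combination a7 - a5

/-- `E` is free of rank 3: its sections are given by `(b₀, b₁, ∂ₓ b₀)`. -/
def bundleEquiv (A : Fin 3 → Fin 2 → Hol) : bundle A ≃ₗ[Hol] (Fin 3 → Hol) where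
  toFun s := ![s.1 0 .o, s.1 1 .o, s.1 0 .x]
  invFun f := ⟨jetOf A (f 0) (f 1) (f 2), jetOf_mem A _ _ _⟩
  map_add' s t := by ext i; fin_cases i <;> rfl
  map_smul' c s := by ext i; fin_cases i <;> rfl
  left_inv s := Subtype.ext (eq_jetOf s.2).symm
  right_inv f := by ext i; fin_cases i <;> rfl

instance (A : Fin 3 → Fin 2 → Hol) : Module.Free Hol (bundle A) :=
  Module.Free.of_equiv (bundleEquiv A).symm

instance (A : Fin 3 → Fin 2 → Hol) : Module.Finite Hol (bundle A) :=
  Module.Finite.equiv (bundleEquiv A).symm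

/-- The covariant derivative `∇_{∂ₓ}` on `E`: the section of `E` whose components of order at most
one are those of `∂ₓ s` minus the shifted jet (see `nablaX_spec`). -/
def nablaX (A : Fin 3 → Fin 2 → Hol) (s : bundle A) : bundle A :=
  ⟨jetOf A (dx (s.1 0 .o) - s.1 0 .x) (dx (s.1 1 .o) - s.1 1 .x) (dx (s.1 0 .x) - s.1 0 .xx),
    jetOf_mem A _ _ _⟩

/-- The covariant derivative `∇_{∂_y}` on `E` (see `nablaY_spec`). -/
def nablaY (A : Fin 3 → Fin 2 → Hol) (s : bundle A) : bundle A :=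
  ⟨jetOf A (dy (s.1 0 .o) - s.1 0 .y) (dy (s.1 1 .o) - s.1 1 .y) (dy (s.1 0 .x) - s.1 0 .xy),
    jetOf_mem A _ _ _⟩

/-- `nablaX` is the `x`-component of the Spencer operator `E → Ω¹ ⊗ J₁(𝒪²)`. -/
theorem nablaX_spec (A : Fin 3 → Fin 2 → Hol) (s : bundle A) (l : Fin 2) :
    (nablaX A s).1 l .o = dx (s.1 l .o) - s.1 l .x ∧
    (nablaX A s).1 l .x = dx (s.1 l .x) - s.1 l .xx ∧
    (nablaX A s).1 l .y = dx (s.1 l .y) - s.1 l .xy := by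
  obtain ⟨s, hs⟩ := s
  have h := eq_jetOf hs
  generalize s 0 .o = u at h
  generalize s 1 .o = v at h
  generalize s 0 .x = w at h
  subst h
  fin_cases l <;> refine ⟨?_, ?_, ?_⟩ <;> simp [nablaX, jetOf] <;> ring

/-- `nablaY` is the `y`-component of the Spencer operator `E → Ω¹ ⊗ J₁(𝒪²)`. -/
theorem nablaY_spec (A : Fin 3 → Fin 2 → Hol) (s : bundle A) (l : Fin 2) :
    (nablaY A s).1 l .o = dy (s.1 l .o) - s.1 l .y ∧
    (nablaY A s).1 l .x = dy (s.1 l .x) - s.1 l .xy ∧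
    (nablaY A s).1 l .y = dy (s.1 l .y) - s.1 l .yy := by
  obtain ⟨s, hs⟩ := s
  have h := eq_jetOf hs
  generalize s 0 .o = u at h
  generalize s 1 .o = v at h
  generalize s 0 .x = w at h
  subst h
  fin_cases l <;> refine ⟨?_, ?_, ?_⟩ <;> simp [nablaY, jetOf] <;> ring

/-- A section of `E` is determined by its components `b₀`, `b₁`, `∂ₓ b₀`. -/
theorem bundle_ext {A : Fin 3 → Fin 2 → Hol} {s t : bundle A} (h0 : s.1 0 .o = t.1 0 .o)
    (h1 : s.1 1 .o = t.1 1 .o) (h2 : s.1 0 .x = t.1 0 .x) : s = t := by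
  apply Subtype.ext
  rw [eq_jetOf s.2, eq_jetOf t.2, h0, h1, h2]

theorem nablaX_add (A : Fin 3 → Fin 2 → Hol) (s t : bundle A) :
    nablaX A (s + t) = nablaX A s + nablaX A t := by
  apply bundle_ext <;> simp [nablaX, jetOf] <;> ring

theorem nablaY_add (A : Fin 3 → Fin 2 → Hol) (s t : bundle A) :
    nablaY A (s + t) = nablaY A s + nablaY A t := by
  apply bundle_ext <;> simp [nablaY, jetOf] <;> ring

theorem nablaX_smul (A : Fin 3 → Fin 2 → Hol) (f : Hol) (s : bundle A) :
    nablaX A (f • s) = f • nablaX A s + dx f • s := by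
  apply bundle_ext <;> simp [nablaX, jetOf] <;> ring

theorem nablaY_smul (A : Fin 3 → Fin 2 → Hol) (f : Hol) (s : bundle A) :
    nablaY A (f • s) = f • nablaY A s + dy f • s := by
  apply bundle_ext <;> simp [nablaY, jetOf] <;> ring

/-- The curvature of `(E, ∇)`: the coefficient `∇ₓ ∇_y - ∇_y ∇ₓ ∈ End(E)` of `dx ∧ dy`. -/
def curvature (A : Fin 3 → Fin 2 → Hol) : bundle A →ₗ[Hol] bundle A where
  toFun s := nablaX A (nablaY A s) - nablaY A (nablaX A s)
  map_add' s t := by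
    simp only [nablaX_add, nablaY_add]
    abel
  map_smul' f s := by
    simp only [nablaX_add, nablaY_add, nablaX_smul, nablaY_smul, dx_dy, RingHom.id_apply, smul_sub]
    abel

/-- The Blaschke–Chern curvature (its coefficient of `dx ∧ dy`) of a 4-web presented by `P`: the
trace of the curvature of the connection `(E, ∇)` associated to `P`. -/
def Web.blaschkeChern (W : Web 4) (P : Hol[X]) : Hol :=
  LinearMap.trace Hol (bundle (W.systemCoeff P)) (curvature (W.systemCoeff P))

end PlaneWeb

end

open Filter Topology Polynomial

noncomputable section

namespace PlaneWeb

/-! ### Germs: values, units, integrality -/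

/-! Part (1). Let `X`, `Y` be the frame dual to `(dF₀, dF₁)`; it commutes, and every condition
becomes an identity between two commuting derivations. Up to units, `dF₂ = m dF₀ + dF₁` and `dF₃ = n
dF₀ + dF₁`, so that `m / n` is the cross-ratio of the four directions. The 3-webs containing both
leaves `0` and `1` give `XY log m = XY log n = κ`. The other two 3-webs then force `κ d log (m / n)
= 0` (`curvature_mul_crossRatio_eq_zero`). Since `𝒪` is a domain and `κ ≠ 0`, the cross-ratio is
constant. An abelian relation is determined by `s = -G₁` and `t = -G₀`, with `X s = Y t = 0`, and
closedness of its component on leaf `2` is one more equation. Differentiating that equation twice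
makes `4κ ds` and `4κ dt` linear in `(s, t)` (`relation_derivatives`). For two relations a nonzero
determinant `δ = s t' - s' t` would satisfy `d log δ = (5/4)(μx dF₀ - μy dF₁) - (1/4) d log κ`,
where `μx`, `μy` are the logarithmic derivatives of `m`. The right side is not closed, its
differential being `-(5/2) κ dF₀ ∧ dF₁`, so `δ = 0` (`relation_det_eq_zero`). Relations with
proportional components are proportional over `ℂ` (`Web.exists_smul_eq`).

Part (2). Euler's identities `∑ pᵢᵏ / qᵢ = 0` for `k < 3` identify abelian relations with solutions
of `ℳ(4)`, and solutions are the horizontal sections of `E`. The curvature of `E` has no components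
of order zero (`curvature_apply_zero`), so its matrix has a single nonzero row, and the trace is the
last entry of that row. If the trace vanishes, two independent relations annihilate the two
remaining entries: their order-zero determinant is nonzero, again by `Web.exists_smul_eq`. The
connection is then flat. The two horizontal sections extend to a basis of `E`, and a third
horizontal section comes from integrating closed 1-forms (`exists_horizontal_section`). Hence rank
at least `2` implies rank at least `3`. -/

theorem Hol.value_mk (f : ℂ × ℂ → ℂ) (hf : AnalyticAt ℂ f 0) : (Hol.mk f hf).value = f 0 := rfl

/-- The value at the origin, as a ring homomorphism. -/
def Hol.eval₀ : Hol →+* ℂ where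
  toFun := Hol.value
  map_one' := rfl
  map_zero' := rfl
  map_mul' φ ψ := by
    induction φ using Hol.ind with | _ f hf
    induction ψ using Hol.ind with | _ g hg
    rfl
  map_add' φ ψ := by
    induction φ using Hol.ind with | _ f hf
    induction ψ using Hol.ind with | _ g hg
    rfl

theorem Hol.eval₀_apply (φ : Hol) : Hol.eval₀ φ = φ.value := rfl

theorem Hol.isUnit_iff {φ : Hol} : IsUnit φ ↔ φ.value ≠ 0 := by
  constructor
  · intro h
    exact (h.map Hol.eval₀).ne_zero
  · induction φ using Hol.ind with | _ f hf
    intro h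
    rw [Hol.value_mk] at h
    refine IsUnit.of_mul_eq_one (Hol.mk _ (hf.inv h)) ?_
    refine Subtype.ext (Germ.coe_eq.2 ?_)
    filter_upwards [hf.continuousAt.eventually_ne h] with z hz
    exact mul_inv_cancel₀ hz

instance : Nontrivial Hol := ⟨0, 1, fun h => zero_ne_one (α := ℂ) (congrArg Hol.eval₀ h)⟩

/-- Setting for the identity theorem: a nonzero germ may vanish at the origin, so one divides by it
near another point `z` of a ball and carries the conclusion back to `0`. -/
theorem exists_preconnected_nhds {f g : ℂ × ℂ → ℂ} {p : ℂ × ℂ → Prop} (hf : AnalyticAt ℂ f 0)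
    (hg : AnalyticAt ℂ g 0) (hp : ∀ᶠ z in 𝓝 0, p z) (h : ¬ g =ᶠ[𝓝 0] 0) :
    ∃ U : Set (ℂ × ℂ), IsOpen U ∧ IsPreconnected U ∧ 0 ∈ U ∧ AnalyticOnNhd ℂ f U ∧
      AnalyticOnNhd ℂ g U ∧ (∀ z ∈ U, p z) ∧ ∃ z ∈ U, g z ≠ 0 := by
  obtain ⟨r, hr, hU⟩ := Metric.eventually_nhds_iff_ball.1
    (hf.eventually_analyticAt.and (hg.eventually_analyticAt.and hp))
  refine ⟨Metric.ball 0 r, Metric.isOpen_ball, (convex_ball _ _).isPreconnected,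
    Metric.mem_ball_self hr, fun z hz => (hU z hz).1, fun z hz => (hU z hz).2.1,
    fun z hz => (hU z hz).2.2, ?_⟩
  by_contra! hc
  exact h (Filter.eventually_of_mem (Metric.ball_mem_nhds _ hr) hc)

instance : NoZeroDivisors Hol where
  eq_zero_or_eq_zero_of_mul_eq_zero {φ ψ} h := by
    induction φ using Hol.ind with | _ f hf
    induction ψ using Hol.ind with | _ g hg
    refine or_iff_not_imp_right.2 fun hn => ?_
    have hfg : f * g =ᶠ[𝓝 0] 0 := Germ.coe_eq.1 (Subtype.ext_iff.1 h)
    obtain ⟨U, hUo, hUc, h0, hfU, hgU, hp, z, hz, hgz⟩ := exists_preconnected_nhds hf hg hfg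
      (fun h' => hn (Subtype.ext (Germ.coe_eq.2 h')))
    have hfz : f =ᶠ[𝓝 z] 0 := by
      filter_upwards [hUo.mem_nhds hz, (hgU z hz).continuousAt.eventually_ne hgz] with w hw hgw
      exact (mul_eq_zero.1 (hp w hw)).resolve_right hgw
    have := hfU.eqOn_zero_of_preconnected_of_eventuallyEq_zero hUc hz hfz
    exact Subtype.ext (Germ.coe_eq.2 (Filter.eventually_of_mem (hUo.mem_nhds h0) this))

instance : IsDomain Hol := NoZeroDivisors.to_isDomain _

instance : CharZero Hol := Hol.eval₀.charZero

theorem ext_partial {f g : ℂ × ℂ →L[ℂ] ℂ} (h1 : f (1, 0) = g (1, 0)) (h2 : f (0, 1) = g (0, 1)) :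
    f = g := by
  ext
  · simpa using h1
  · simpa using h2

/-- A quotient of two germs with vanishing differential is constant. -/
theorem Hol.exists_smul_eq {φ ψ : Hol} (hψ : ψ ≠ 0) (hx : φ * dx ψ = ψ * dx φ)
    (hy : φ * dy ψ = ψ * dy φ) : ∃ c : ℂ, φ = c • ψ := by
  induction φ using Hol.ind with | _ f hf
  induction ψ using Hol.ind with | _ g hg
  rw [dx, dir_mk, dir_mk] at hx
  rw [dy, dir_mk, dir_mk] at hy
  have hx' := Germ.coe_eq.1 (Subtype.ext_iff.1 hx)
  have hy' := Germ.coe_eq.1 (Subtype.ext_iff.1 hy)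
  obtain ⟨U, hUo, hUc, h0, hfU, hgU, hp, z, hz, hgz⟩ := exists_preconnected_nhds hf hg
    (hx'.and hy') (fun h' => hψ (Subtype.ext (Germ.coe_eq.2 h')))
  -- The quotient `f / g` is considered only on a small ball around `z` where `g` has no zero; it is
  -- constant there because its differential vanishes.
  obtain ⟨r, hr, hV⟩ := Metric.eventually_nhds_iff_ball.1
    ((hUo.eventually_mem hz).and ((hgU z hz).continuousAt.eventually_ne hgz))
  obtain ⟨c, hc⟩ := Metric.isOpen_ball.exists_is_const_of_fderiv_eq_zero (𝕜 := ℂ)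
    (f := fun w => f w / g w) (s := Metric.ball z r) (convex_ball _ _).isPreconnected
    (fun w hw => ((hfU w (hV w hw).1).fun_div
      (hgU w (hV w hw).1) (hV w hw).2).differentiableAt.differentiableWithinAt)
    (fun w hw => by
      obtain ⟨hwU, hgw⟩ := hV w hw
      obtain ⟨h1, h2⟩ := hp w hwU
      beta_reduce at h1 h2
      have hd := (hfU w hwU).differentiableAt.hasFDerivAt.mul
        ((hasDerivAt_inv hgw).comp_hasFDerivAt w (hgU w hwU).differentiableAt.hasFDerivAt)
      change fderiv ℂ (fun w => f w * (g w)⁻¹) w = 0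
      rw [show (fun w => f w * (g w)⁻¹) = f * (fun t => t⁻¹) ∘ g from rfl, hd.fderiv]
      apply ext_partial
      · simp only [add_apply, smul_apply, smul_eq_mul,
          zero_apply, Function.comp_apply]
        field_simp
        linear_combination -h1
      · simp only [add_apply, smul_apply, smul_eq_mul,
          zero_apply, Function.comp_apply]
        field_simp
        linear_combination -h2)
  refine ⟨c, Subtype.ext (Germ.coe_eq.2 ?_)⟩
  have hzero : (f - fun x => c • g x) =ᶠ[𝓝 z] 0 := by
    filter_upwards [Metric.ball_mem_nhds z hr] with w hw
    have := hc w hw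
    rw [div_eq_iff (hV w hw).2] at this
    simp [this]
  have := (hfU.sub (analyticOnNhd_const.smul hgU)).eqOn_zero_of_preconnected_of_eventuallyEq_zero
    hUc hz hzero
  filter_upwards [hUo.mem_nhds h0] with w hw
  exact sub_eq_zero.1 (this hw)

/-! ### Formal Taylor expansion -/

/-- At `t = 0` this expresses the Taylor coefficients of a germ along a ray through values of its
iterated directional derivatives, which stay in any stable ideal. -/
theorem iteratedDeriv_ray (z : ℂ × ℂ) (k : ℕ) (φ : Hol) :
    iteratedDeriv k (fun t : ℂ => φ.rep (t • z)) =ᶠ[𝓝 0]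
      fun t => ((dir z)^[k] φ).rep (t • z) := by
  induction k generalizing φ with
  | zero => simp
  | succ k ih =>
    have hcont : Tendsto (fun t : ℂ => t • z) (𝓝 0) (𝓝 0) := by
      have : ContinuousAt (fun t : ℂ => t • z) 0 := by fun_prop
      simpa [ContinuousAt] using this
    have h1 := (ih φ).deriv
    rw [iteratedDeriv_succ]
    refine h1.trans ?_
    rw [Function.iterate_succ_apply']
    set ψ := (dir z)^[k] φ
    have h2 : (dir z ψ).rep =ᶠ[𝓝 0] fun w => fderiv ℂ ψ.rep w z := by
      have := (dir z ψ).mk_rep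
      conv_rhs at this => rw [← ψ.mk_rep, dir_mk]
      exact Hol.mk_eq_mk.1 this
    filter_upwards [hcont.eventually h2, hcont.eventually ψ.rep_analyticAt.eventually_analyticAt]
      with t ht ha
    rw [ht]
    have hl : HasDerivAt (fun t : ℂ => t • z) z t := by
      simpa using (hasDerivAt_id t).smul_const z
    exact (ha.differentiableAt.hasFDerivAt.comp_hasDerivAt t hl).deriv

/-- An ideal of `𝒪` that is stable under the derivations and whose members vanish at the origin is
zero. -/
theorem Hol.eq_zero_of_mem {I : Ideal Hol} (hx : ∀ φ ∈ I, dx φ ∈ I) (hy : ∀ φ ∈ I, dy φ ∈ I)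
    (hv : ∀ φ ∈ I, φ.value = 0) {φ : Hol} (hφ : φ ∈ I) : φ = 0 := by
  have hdir : ∀ (z : ℂ × ℂ), ∀ ψ ∈ I, dir z ψ ∈ I := by
    intro z ψ hψ
    have : dir z ψ = Hol.const z.1 * dx ψ + Hol.const z.2 * dy ψ := by
      induction ψ using Hol.ind with | _ f hf
      rw [dx, dy, dir_mk, dir_mk, dir_mk]
      refine Subtype.ext (Germ.coe_eq.2 (Eventually.of_forall fun w => ?_))
      have e : z = z.1 • ((1, 0) : ℂ × ℂ) + z.2 • ((0, 1) : ℂ × ℂ) := by ext <;> simp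
      change fderiv ℂ f w z = z.1 * fderiv ℂ f w (1, 0) + z.2 * fderiv ℂ f w (0, 1)
      conv_lhs => rw [e, map_add, map_smul, map_smul]
      rfl
    rw [this]
    exact I.add_mem (I.mul_mem_left _ (hx ψ hψ)) (I.mul_mem_left _ (hy ψ hψ))
  have hiter : ∀ (z : ℂ × ℂ) (k : ℕ), (dir z)^[k] φ ∈ I := by
    intro z k
    induction k with
    | zero => exact hφ
    | succ k ih => rw [Function.iterate_succ_apply']; exact hdir z _ ih
  rw [← φ.mk_rep]
  refine Subtype.ext (Germ.coe_eq.2 ?_)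
  obtain ⟨r, hr, hU⟩ := Metric.eventually_nhds_iff_ball.1 φ.rep_analyticAt.eventually_analyticAt
  filter_upwards [Metric.ball_mem_nhds (0 : ℂ × ℂ) (half_pos hr)] with z hz
  have hz' : ‖z‖ < r / 2 := by simpa using hz
  -- Taking `‖z‖ < r / 2` leaves room for `|t| < 2`, so that the Taylor series at `0` converges at
  -- `t = 1`.
  have hdiff : DifferentiableOn ℂ (fun t : ℂ => φ.rep (t • z)) (Metric.ball 0 2) := by
    intro t ht
    have ht' : ‖t‖ < 2 := by simpa using ht
    have hmem : t • z ∈ Metric.ball (0 : ℂ × ℂ) r := by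
      rw [mem_ball_zero_iff, norm_smul]
      nlinarith [norm_nonneg t, norm_nonneg z]
    have h1 := (hU _ hmem).differentiableAt
    exact (DifferentiableAt.comp t h1 (by fun_prop)).differentiableWithinAt
  have hs := Complex.hasSum_taylorSeries_on_ball (r := 2) hdiff (z := 1) (by simp)
  have h0 : ∀ k, iteratedDeriv k (fun t : ℂ => φ.rep (t • z)) 0 = 0 := by
    intro k
    have e := (iteratedDeriv_ray z k φ).eq_of_nhds
    rw [e, zero_smul]
    have := hv _ (hiter z k)
    rw [← Hol.mk_rep ((dir z)^[k] φ)] at this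
    exact this
  simp only [h0, smul_zero, one_smul] at hs
  exact hs.unique hasSum_zero

/-! ### Primitives, exponentials -/

/-- A primitive of an analytic 1-form is analytic. -/
theorem analyticAt_of_hasFDerivAt {f : ℂ × ℂ → ℂ} {ω : ℂ × ℂ → ℂ × ℂ →L[ℂ] ℂ}
    (hω : AnalyticAt ℂ ω 0) (hf : ∀ᶠ z in 𝓝 0, HasFDerivAt f (ω z) z) : AnalyticAt ℂ f 0 := by
  obtain ⟨p, R, hp⟩ := hω
  -- Integrating `ω (t z) z` over `t ∈ [0, 1]` term by term multiplies the term of degree `n` by `∫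
  -- tⁿ = 1 / (n + 1)`; the shifted series is then the expansion of `f`.
  let p' : FormalMultilinearSeries ℂ (ℂ × ℂ) (ℂ × ℂ →L[ℂ] ℂ) := fun n => ((n : ℂ) + 1)⁻¹ • p n
  have hn : ∀ n : ℕ, ‖((n : ℂ) + 1)⁻¹‖ ≤ 1 := by
    intro n
    rw [norm_inv]
    refine inv_le_one_of_one_le₀ ?_
    have : ((n : ℂ) + 1) = ((n + 1 : ℕ) : ℂ) := by push_cast; rfl
    rw [this, Complex.norm_natCast]
    exact_mod_cast Nat.succ_le_succ (Nat.zero_le n)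
  have hrad : p.radius ≤ p'.radius := FormalMultilinearSeries.radius_le_of_le fun n => by
    change ‖((n : ℂ) + 1)⁻¹ • p n‖ ≤ _
    rw [norm_smul]
    exact mul_le_of_le_one_left (norm_nonneg _) (hn n)
  have hpos : 0 < p'.radius := (hp.r_pos.trans_le hp.r_le).trans_le hrad
  have hu := (p'.hasFPowerSeriesOnBall hpos).unshift (z := f 0)
  refine hu.analyticAt.congr ?_
  obtain ⟨r, hr, hU⟩ := Metric.eventually_nhds_iff_ball.1 hf
  filter_upwards [Metric.ball_mem_nhds (0 : ℂ × ℂ) hr, Metric.eball_mem_nhds (0 : ℂ × ℂ) hp.r_pos]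
    with z hz hzR
  have hmem : ∀ t ∈ Set.uIcc (0 : ℝ) 1, ((t : ℂ) • z) ∈ Metric.ball (0 : ℂ × ℂ) r ∧
      ((t : ℂ) • z) ∈ Metric.eball (0 : ℂ × ℂ) R := by
    intro t ht
    rw [Set.uIcc_of_le zero_le_one] at ht
    have h1 : ‖(t : ℂ) • z‖ ≤ ‖z‖ := by
      rw [norm_smul, Complex.norm_real, Real.norm_eq_abs, abs_of_nonneg ht.1]
      exact mul_le_of_le_one_left (norm_nonneg _) ht.2
    constructor
    · rw [mem_ball_zero_iff] at hz ⊢; exact h1.trans_lt hz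
    · rw [mem_eball_zero_iff] at hzR ⊢
      refine lt_of_le_of_lt ?_ hzR
      rw [enorm_le_iff_norm_le]; exact h1
  have hderiv : ∀ t ∈ Set.uIcc (0 : ℝ) 1,
      HasDerivAt (fun s : ℝ => f ((s : ℂ) • z)) (ω ((t : ℂ) • z) z) t := by
    intro t ht
    have h1 : HasDerivAt (fun s : ℂ => s • z) z (t : ℂ) := by
      simpa using (hasDerivAt_id (t : ℂ)).smul_const z
    exact ((hU _ (hmem t ht).1).comp_hasDerivAt (t : ℂ) h1).comp_ofReal
  have hterm : ∀ (t : ℝ) (n : ℕ), (p n fun _ => (t : ℂ) • z) z = (t : ℂ) ^ n * (p n fun _ => z) z := by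
    intro t n
    rw [show (fun _ : Fin n => (t : ℂ) • z) = fun i => (fun _ => (t : ℂ)) i • (fun _ => z) i from rfl,
      (p n).map_smul_univ]
    simp
  have hsum := intervalIntegral.hasSum_integral_of_dominated_convergence
    (μ := MeasureTheory.volume) (a := 0) (b := 1)
    (F := fun (n : ℕ) (t : ℝ) => (p n fun _ => (t : ℂ) • z) z)
    (f := fun t : ℝ => ω ((t : ℂ) • z) z)
    (fun n _ => ‖p n fun _ => z‖ * ‖z‖)
    (fun n => by
      simp only [hterm]
      exact (by fun_prop : Continuous fun t : ℝ => (t : ℂ) ^ n * (p n fun _ => z) z).aestronglyMeasurable)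
    (fun n => Eventually.of_forall fun t ht => by
      rw [hterm, norm_mul, norm_pow, Complex.norm_real, Real.norm_eq_abs]
      rw [Set.uIoc_of_le zero_le_one] at ht
      rw [abs_of_nonneg ht.1.le]
      exact (mul_le_of_le_one_left (norm_nonneg _) (pow_le_one₀ ht.1.le ht.2)).trans
        ((p n fun _ => z).le_opNorm z))
    (Eventually.of_forall fun t ht =>
      (p.summable_norm_apply (Metric.eball_subset_eball hp.r_le hzR)).mul_right _)
    (by simp)
    (Eventually.of_forall fun t ht => by
      have := hp.hasSum (hmem t (Set.uIoc_subset_uIcc ht)).2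
      rw [zero_add] at this
      exact (ContinuousLinearMap.apply ℂ ℂ z).hasSum this)
  have hcont : ContinuousOn (fun t : ℝ => ω ((t : ℂ) • z) z) (Set.uIcc 0 1) := by
    intro t ht
    have h1 : ContinuousAt ω ((t : ℂ) • z) :=
      (hp.analyticAt_of_mem (hmem t ht).2).continuousAt
    have h2 : ContinuousAt (fun s : ℝ => ω ((s : ℂ) • z)) t :=
      ContinuousAt.comp (f := fun s : ℝ => (s : ℂ) • z) (g := ω) h1 (by fun_prop)
    exact (h2.clm_apply continuousAt_const).continuousWithinAt
  rw [intervalIntegral.integral_eq_sub_of_hasDerivAt hderiv hcont.intervalIntegrable] at hsum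
  have hsum2 : HasSum (fun n => (p' n fun _ => z) z) (p'.sum z z) := by
    have h := p'.hasSum (Metric.eball_subset_eball (hp.r_le.trans hrad) hzR)
    have h' := (ContinuousLinearMap.apply ℂ ℂ z).hasSum h
    simpa only [ContinuousLinearMap.apply_apply] using h'
  have hterms : ∀ n : ℕ, ∫ t in (0 : ℝ)..1, (p n fun _ => (t : ℂ) • z) z = (p' n fun _ => z) z := by
    intro n
    simp only [hterm]
    rw [intervalIntegral.integral_mul_const]
    have : ∫ t in (0 : ℝ)..1, (t : ℂ) ^ n = ((n : ℂ) + 1)⁻¹ := by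
      have := integral_pow (a := 0) (b := 1) n
      have h2 : (fun t : ℝ => (t : ℂ) ^ n) = fun t : ℝ => ((t ^ n : ℝ) : ℂ) := by
        funext t; push_cast; rfl
      rw [h2, intervalIntegral.integral_ofReal, this]
      simp
    rw [this]
    rfl
  simp only [hterms] at hsum
  have := hsum.unique hsum2
  simp only [Complex.ofReal_one, one_smul, Complex.ofReal_zero, zero_smul] at this
  rw [sub_zero, ← this]
  ring

/-- Closed germs of holomorphic 1-forms are exact. -/
theorem Hol.exists_primitive {a b : Hol} (h : dx b = dy a) : ∃ φ : Hol, dx φ = a ∧ dy φ = b := by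
  induction a using Hol.ind with | _ f hf
  induction b using Hol.ind with | _ g hg
  rw [dx, dy, dir_mk, dir_mk, Hol.mk_eq_mk] at h
  let ω : ℂ × ℂ → ℂ × ℂ →L[ℂ] ℂ := fun z =>
    f z • ContinuousLinearMap.fst ℂ ℂ ℂ + g z • ContinuousLinearMap.snd ℂ ℂ ℂ
  have hω : AnalyticAt ℂ ω 0 := (hf.smul analyticAt_const).add (hg.smul analyticAt_const)
  obtain ⟨r, hr, hU⟩ := Metric.eventually_nhds_iff_ball.1
    (hf.eventually_analyticAt.and (hg.eventually_analyticAt.and h))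
  have hd : ∀ z ∈ Metric.ball (0 : ℂ × ℂ) r, HasFDerivAt ω
      ((fderiv ℂ f z).smulRight (ContinuousLinearMap.fst ℂ ℂ ℂ) +
        (fderiv ℂ g z).smulRight (ContinuousLinearMap.snd ℂ ℂ ℂ)) z := fun z hz =>
    ((hU z hz).1.differentiableAt.hasFDerivAt.smul_const (ContinuousLinearMap.fst ℂ ℂ ℂ)).add
      ((hU z hz).2.1.differentiableAt.hasFDerivAt.smul_const (ContinuousLinearMap.snd ℂ ℂ ℂ))
  -- Poincaré lemma on a ball: the symmetry of `dω` is exactly the closedness condition `h`.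
  obtain ⟨u, hu⟩ := (convex_ball (0 : ℂ × ℂ) r).exists_forall_hasFDerivWithinAt_of_hasFDerivWithinAt_symmetric
    (𝕜 := ℂ) (ω := ω) (dω := fun z => ((fderiv ℂ f z).smulRight (ContinuousLinearMap.fst ℂ ℂ ℂ) +
        (fderiv ℂ g z).smulRight (ContinuousLinearMap.snd ℂ ℂ ℂ)).restrictScalars ℝ)
    (fun z hz => ((hd z hz).restrictScalars ℝ).hasFDerivWithinAt) (by
      intro z hz v _ w _
      have e : ∀ (L : ℂ × ℂ →L[ℂ] ℂ) (v : ℂ × ℂ), L v = v.1 * L (1, 0) + v.2 * L (0, 1) := by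
        intro L v
        have : v = v.1 • ((1, 0) : ℂ × ℂ) + v.2 • ((0, 1) : ℂ × ℂ) := by ext <;> simp
        conv_lhs => rw [this, map_add, map_smul, map_smul]
        rfl
      have h1 := (hU z hz).2.2
      simp only [add_apply, ContinuousLinearMap.coe_restrictScalars', ContinuousLinearMap.smulRight_apply,
        smul_apply, ContinuousLinearMap.coe_fst',
        ContinuousLinearMap.coe_snd', smul_eq_mul]
      rw [e _ v, e _ w, e (fderiv ℂ g z) v, e (fderiv ℂ g z) w]
      linear_combination (v.1 * w.2 - w.1 * v.2) * h1)
  have hu' : ∀ z ∈ Metric.ball (0 : ℂ × ℂ) r, HasFDerivAt u (ω z) z := fun z hz =>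
    (hu z hz).hasFDerivAt (Metric.isOpen_ball.mem_nhds hz)
  have hev : ∀ᶠ z in 𝓝 (0 : ℂ × ℂ), HasFDerivAt u (ω z) z :=
    Filter.eventually_of_mem (Metric.ball_mem_nhds _ hr) hu'
  refine ⟨Hol.mk u (analyticAt_of_hasFDerivAt hω hev), ?_, ?_⟩
  · rw [dx, dir_mk, Hol.mk_eq_mk]
    filter_upwards [hev] with z hz
    simp [hz.fderiv, ω]
  · rw [dy, dir_mk, Hol.mk_eq_mk]
    filter_upwards [hev] with z hz
    simp [hz.fderiv, ω]

/-- The exponential of a germ. -/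
theorem Hol.exists_exp (φ : Hol) :
    ∃ ε : Hol, IsUnit ε ∧ dx ε = dx φ * ε ∧ dy ε = dy φ * ε := by
  induction φ using Hol.ind with | _ f hf
  have key : ∀ v, dir v (Hol.mk (fun z => Complex.exp (f z)) hf.cexp) =
      dir v (Hol.mk f hf) * Hol.mk (fun z => Complex.exp (f z)) hf.cexp := by
    intro v
    rw [dir_mk, dir_mk]
    refine Subtype.ext (Germ.coe_eq.2 ?_)
    filter_upwards [hf.eventually_analyticAt] with z hz
    rw [hz.differentiableAt.hasFDerivAt.cexp.fderiv]
    simp [mul_comm]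
  exact ⟨Hol.mk _ hf.cexp, Hol.isUnit_iff.2 (Complex.exp_ne_zero _), key _, key _⟩

/-! ### Germs that are functions of a given germ -/

theorem wedge_dFun_eq_zero {φ G : Hol} (hφ : φ.value = 0) {g : ℂ → ℂ} (hg : AnalyticAt ℂ g 0)
    (h : (G : Germ (𝓝 (0 : ℂ × ℂ)) ℂ) = Germ.map g (φ : Germ (𝓝 (0 : ℂ × ℂ)) ℂ)) :
    wedge (dFun G) (dFun φ) = 0 := by
  induction φ using Hol.ind with | _ f hf
  rw [Hol.value_mk] at hφ
  have hgf : AnalyticAt ℂ (fun z => g (f z)) 0 := by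
    have : AnalyticAt ℂ g (f 0) := by rwa [hφ]
    exact this.comp hf
  have hG : G = Hol.mk (fun z => g (f z)) hgf := Subtype.ext h
  subst hG
  have hd : ∀ᶠ z in 𝓝 0, ∀ v,
      fderiv ℂ (fun z => g (f z)) z v = deriv g (f z) * fderiv ℂ f z v := by
    have hc : Tendsto f (𝓝 0) (𝓝 0) := by simpa [ContinuousAt, hφ] using hf.continuousAt
    filter_upwards [hf.eventually_analyticAt, hc.eventually hg.eventually_analyticAt]
      with z h1 h2 v
    have := h2.differentiableAt.hasDerivAt.comp_hasFDerivAt z h1.differentiableAt.hasFDerivAt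
    rw [show (fun z => g (f z)) = g ∘ f from rfl, this.fderiv]
    simp
  simp only [wedge, dFun]
  rw [dx, dy, dir_mk, dir_mk, dir_mk, dir_mk, sub_eq_zero]
  refine Subtype.ext (Germ.coe_eq.2 ?_)
  filter_upwards [hd] with z hz
  simp only [hz]
  ring

/-- Converse of `wedge_dFun_eq_zero`. As `∂_y φ` is a unit, `(x, φ)` is a local chart; in it the
wedge condition says that `G` does not depend on the first coordinate, so `G` is its restriction to
`x = 0`. -/
theorem exists_map_eq {φ G : Hol} (hφ : φ.value = 0) (hy : IsUnit (dy φ))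
    (h : wedge (dFun G) (dFun φ) = 0) : ∃ g : ℂ → ℂ, AnalyticAt ℂ g 0 ∧
      (G : Germ (𝓝 (0 : ℂ × ℂ)) ℂ) = Germ.map g (φ : Germ (𝓝 (0 : ℂ × ℂ)) ℂ) := by
  induction φ using Hol.ind with | _ f hf
  induction G using Hol.ind with | _ u hu
  rw [Hol.value_mk] at hφ
  simp only [wedge, dFun] at h
  rw [dx, dy, dir_mk, dir_mk, dir_mk, dir_mk, sub_eq_zero] at h
  have h' := Germ.coe_eq.1 (Subtype.ext_iff.1 h)
  rw [Hol.isUnit_iff, dy, dir_mk, Hol.value_mk] at hy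
  let Φ : ℂ × ℂ → ℂ × ℂ := fun z => (z.1, f z)
  have hΦ : AnalyticAt ℂ Φ 0 := analyticAt_fst.prod hf
  have hΦ0 : Φ 0 = 0 := by simp [Φ, hφ]
  let L : ℂ × ℂ →L[ℂ] ℂ × ℂ := (ContinuousLinearMap.fst ℂ ℂ ℂ).prod (fderiv ℂ f 0)
  have hL : HasStrictFDerivAt Φ L 0 :=
    (hasStrictFDerivAt_fst).prodMk hf.hasStrictFDerivAt
  have e : ∀ (l : ℂ × ℂ →L[ℂ] ℂ) (v : ℂ × ℂ), l v = v.1 * l (1, 0) + v.2 * l (0, 1) := by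
    intro l v
    have : v = v.1 • ((1, 0) : ℂ × ℂ) + v.2 • ((0, 1) : ℂ × ℂ) := by ext <;> simp
    conv_lhs => rw [this, map_add, map_smul, map_smul]
    rfl
  have hinj : LinearMap.ker (L : ℂ × ℂ →ₗ[ℂ] ℂ × ℂ) = ⊥ := by
    rw [LinearMap.ker_eq_bot']
    intro v hv
    have h1 : v.1 = 0 := congrArg Prod.fst hv
    have h2 : fderiv ℂ f 0 v = 0 := congrArg Prod.snd hv
    rw [e _ v, h1, zero_mul, zero_add] at h2
    exact Prod.ext h1 ((mul_eq_zero.1 h2).resolve_right hy)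
  let i : (ℂ × ℂ) ≃L[ℂ] ℂ × ℂ := (LinearEquiv.ofInjectiveEndo (L : ℂ × ℂ →ₗ[ℂ] ℂ × ℂ)
    (LinearMap.ker_eq_bot.1 hinj)).toContinuousLinearEquiv
  have hi : (i : ℂ × ℂ →L[ℂ] ℂ × ℂ) = L := by ext <;> rfl
  have hS : HasStrictFDerivAt Φ (i : ℂ × ℂ →L[ℂ] ℂ × ℂ) 0 := by rw [hi]; exact hL
  let E := hS.toOpenPartialHomeomorph Φ
  have h0s : (0 : ℂ × ℂ) ∈ E.source := hS.mem_toOpenPartialHomeomorph_source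
  have hE : ∀ z, E z = Φ z := fun z => rfl
  have hΨ : AnalyticAt ℂ E.symm 0 := by
    have := E.analyticAt_symm' (i := i) h0s hΦ hS.hasFDerivAt.fderiv
    rwa [hE, hΦ0] at this
  have hΨ0 : E.symm 0 = 0 := by
    have := E.left_inv h0s
    rwa [hE, hΦ0] at this
  have hv : AnalyticAt ℂ (fun w => u (E.symm w)) 0 := by
    have : AnalyticAt ℂ u (E.symm 0) := by rwa [hΨ0]
    exact this.comp hΨ
  -- the first partial derivative of `u ∘ E.symm` vanishes
  have hpart : ∀ᶠ w in 𝓝 (0 : ℂ × ℂ), fderiv ℂ (fun w => u (E.symm w)) w (1, 0) = 0 := by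
    have hc : Tendsto E.symm (𝓝 0) (𝓝 0) := by simpa [ContinuousAt, hΨ0] using hΨ.continuousAt
    have h0t : (0 : ℂ × ℂ) ∈ E.target := by
      have := E.map_source h0s
      rwa [hE, hΦ0] at this
    have hfy : ∀ᶠ z in 𝓝 (0 : ℂ × ℂ), fderiv ℂ f z (0, 1) ≠ 0 :=
      (analyticAt_fderiv_apply hf _).continuousAt.eventually_ne hy
    filter_upwards [hΨ.eventually_analyticAt, E.open_target.mem_nhds h0t, hc.eventually h',
      hc.eventually hfy, hc.eventually hf.eventually_analyticAt,
      hc.eventually hu.eventually_analyticAt,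
      E.open_target.eventually_mem h0t |>.eventually_nhds] with w hw ht hwed hne hfa hua htt
    set z := E.symm w
    set q := fderiv ℂ E.symm w (1, 0)
    have hd := hw.differentiableAt.hasFDerivAt
    have h1 : HasFDerivAt (fun w => (E.symm w).1)
        ((ContinuousLinearMap.fst ℂ ℂ ℂ).comp (fderiv ℂ E.symm w)) w :=
      hasFDerivAt_fst.comp w hd
    have h2 : HasFDerivAt (fun w => f (E.symm w)) ((fderiv ℂ f z).comp (fderiv ℂ E.symm w)) w :=
      hfa.differentiableAt.hasFDerivAt.comp w hd
    have h3 : HasFDerivAt (fun w => u (E.symm w)) ((fderiv ℂ u z).comp (fderiv ℂ E.symm w)) w :=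
      hua.differentiableAt.hasFDerivAt.comp w hd
    have hr : ∀ᶠ x in 𝓝 w, Φ (E.symm x) = x := by
      filter_upwards [htt] with x hx
      exact E.right_inv hx
    have k1 : fderiv ℂ (fun w : ℂ × ℂ => w.1) w = fderiv ℂ (fun w => (E.symm w).1) w := by
      refine Filter.EventuallyEq.fderiv_eq ?_
      filter_upwards [hr] with x hx
      exact (congrArg Prod.fst hx).symm
    have k2 : fderiv ℂ (fun w : ℂ × ℂ => w.2) w = fderiv ℂ (fun w => f (E.symm w)) w := by
      refine Filter.EventuallyEq.fderiv_eq ?_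
      filter_upwards [hr] with x hx
      exact (congrArg Prod.snd hx).symm
    rw [h1.fderiv, fderiv_fst] at k1
    rw [h2.fderiv, fderiv_snd] at k2
    have l1 : (1 : ℂ) = q.1 := by simpa using congrArg (fun l => l (1, 0)) k1
    have l2 : (0 : ℂ) = fderiv ℂ f z q := by simpa using congrArg (fun l => l (1, 0)) k2
    rw [h3.fderiv]
    change fderiv ℂ u z q = 0
    rw [e _ q, ← l1] at l2 ⊢
    refine (mul_eq_zero.1 ?_).resolve_right hne
    linear_combination hwed - (fderiv ℂ u z) (0, 1) * l2
  obtain ⟨r, hr, hU⟩ := Metric.eventually_nhds_iff_ball.1 (hpart.and hv.eventually_analyticAt)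
  refine ⟨fun t => u (E.symm (0, t)), ?_, Germ.coe_eq.2 ?_⟩
  · have hk : AnalyticAt ℂ (fun t : ℂ => ((0, t) : ℂ × ℂ)) 0 := by fun_prop
    exact AnalyticAt.comp (f := fun t : ℂ => ((0, t) : ℂ × ℂ)) hv hk
  · have hc : Tendsto Φ (𝓝 0) (𝓝 0) := by simpa [ContinuousAt, hΦ0] using hΦ.continuousAt
    filter_upwards [E.open_source.mem_nhds h0s, hc.eventually (Metric.ball_mem_nhds 0 hr)]
      with z hzs hzr
    change u z = u (E.symm (0, f z))
    have hzeq : E.symm (z.1, f z) = z := E.left_inv hzs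
    have hz2 : ‖z.1‖ < r ∧ ‖f z‖ < r := by simpa [Φ, Prod.norm_def] using hzr
    have hmem : ∀ s ∈ Metric.ball (0 : ℂ) r, (s, f z) ∈ Metric.ball (0 : ℂ × ℂ) r := by
      intro s hs
      rw [mem_ball_zero_iff] at hs ⊢
      exact max_lt hs hz2.2
    have hder : ∀ s ∈ Metric.ball (0 : ℂ) r,
        HasDerivAt (fun s => u (E.symm (s, f z))) 0 s := by
      intro s hs
      have h1 := (hU _ (hmem s hs)).2.differentiableAt.hasFDerivAt
      have h2 : HasDerivAt (fun s : ℂ => (s, f z)) ((1, 0) : ℂ × ℂ) s :=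
        (hasDerivAt_id s).prodMk (hasDerivAt_const s _)
      have h3 := h1.comp_hasDerivAt s h2
      rwa [(hU _ (hmem s hs)).1] at h3
    -- Slide the first coordinate from `z.1` to `0` with the second fixed at `f z`; the segment
    -- stays in the ball because the norm on the product is the maximum.
    have hconst := Metric.isOpen_ball.is_const_of_deriv_eq_zero (𝕜 := ℂ)
      (f := fun s => u (E.symm (s, f z))) (s := Metric.ball (0 : ℂ) r)
      (convex_ball _ _).isPreconnected
      (fun s hs => (hder s hs).differentiableAt.differentiableWithinAt)
      (fun s hs => (hder s hs).deriv) (x := z.1) (y := 0)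
      (by simpa using hz2.1) (Metric.mem_ball_self hr)
    rw [← hconst, hzeq]

/-! ### Commuting derivations -/

section Derivations

variable {k R : Type*} [CommRing k] [CommRing R] [Algebra k R] {X Y : Derivation k R R}

/-- Logarithmic derivatives of a unit satisfy the integrability condition. -/
theorem logDeriv_comm (hXY : ∀ f, X (Y f) = Y (X f)) {u α β : R} (hu : IsUnit u)
    (hα : X u = u * α) (hβ : Y u = u * β) : X β = Y α := by
  have h := hXY u
  rw [hα, hβ, X.leibniz, Y.leibniz, hα, hβ] at h
  simp only [smul_eq_mul] at h
  refine hu.mul_left_cancel ?_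
  linear_combination h

/-- In the frame of the leaves `0`, `1`, if the four Blaschke curvatures of a 4-web coincide with
`κ`, then the logarithmic differential of the cross-ratio `m / n` is annihilated by `κ`. The
logarithmic derivatives of `m`, `n` are `μ`, `ν`, and `E = (m - n)⁻¹`. -/
theorem curvature_mul_crossRatio_eq_zero (hXY : ∀ f, X (Y f) = Y (X f))
    {m n E μx μy νx νy κ : R} (hm : X m = m * μx) (hm' : Y m = m * μy) (hn : X n = n * νx)
    (hn' : Y n = n * νy) (hmn : IsUnit (m * n)) (hE : E * (m - n) = 1)
    (hμ : X μy = κ) (hμ' : Y μx = κ)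
    (hν : X νy = κ) (hν' : Y νx = κ)
    (hB : Y (E * (m * n * (μy - νy))) = X (E * (m * μy - n * νy)) - κ)
    (hC : X (E * (μx - νx)) = Y (E * (m * μx - n * νx)) - κ) :
    κ * (μx - νx) = 0 ∧ κ * (μy - νy) = 0 := by
  have hEu : E * E * (m - n) ^ 2 = 1 := by linear_combination (E * (m - n) + 1) * hE
  have hEX : X E = -(E * E * (m * μx - n * νx)) := by
    have h := congrArg X hE
    simp only [Derivation.leibniz, map_sub, smul_eq_mul, Derivation.map_one_eq_zero, hm, hn] at h
    linear_combination E * h - X E * hE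
  have hEY : Y E = -(E * E * (m * μy - n * νy)) := by
    have h := congrArg Y hE
    simp only [Derivation.leibniz, map_sub, smul_eq_mul, Derivation.map_one_eq_zero, hm', hn'] at h
    linear_combination E * h - Y E * hE
  have hx0 : Y (μx - νx) = 0 := by rw [map_sub, hμ', hν', sub_self]
  have hy0 : X (μy - νy) = 0 := by rw [map_sub, hμ, hν, sub_self]
  -- Expanding `hC` cancels `κ` and leaves an equation for `X (μx - νx)` that is linear and
  -- homogeneous in `μx - νx`; `hB` does the same for `Y (μy - νy)`.
  have hx1 : (m - n) * X (μx - νx) = (μx - νx) * (m * μx - n * νx - m * n * (μy - νy)) := by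
    rw [X.leibniz, Y.leibniz, hEX, hEY] at hC
    simp only [Derivation.leibniz, map_sub Y, smul_eq_mul, hm', hn', hμ', hν'] at hC
    have h1 : E * X (μx - νx) =
        E * E * ((μx - νx) * (m * μx - n * νx - m * n * (μy - νy))) := by
      linear_combination hC + (κ - E * (m * μx * μy - n * νx * νy)) * hE
    linear_combination (m - n) ^ 2 * h1 - (m - n) * X (μx - νx) * hE +
      (μx - νx) * (m * μx - n * νx - m * n * (μy - νy)) * hEu
  have hy1 : (m - n) * Y (μy - νy) = (μy - νy) * (n * μy - m * νy - (μx - νx)) := by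
    rw [Y.leibniz, X.leibniz, hEX, hEY] at hB
    simp only [Derivation.leibniz, map_sub X, smul_eq_mul, hm, hm', hn, hn', hμ, hν] at hB
    have h1 : E * Y (μy - νy) = E * E * ((μy - νy) * (n * μy - m * νy - (μx - νx))) := by
      refine hmn.mul_left_cancel ?_
      linear_combination hB + (κ - E * (m * μx * μy - n * νx * νy) +
        E * (m * n * (μy - νy) * (μy + νy))) * hE
    linear_combination (m - n) ^ 2 * h1 - (m - n) * Y (μy - νy) * hE +
      (μy - νy) * (n * μy - m * νy - (μx - νx)) * hEu
  -- Compatibility conditions: `YX (μx - νx) = XY (μx - νx) = 0` because `Y (μx - νx) = 0`, and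
  -- symmetrically for the other difference. First derivatives of the differences are then
  -- eliminated with `hx1` and `hy1`.
  have hx2 := congrArg Y hx1
  have hy2 := congrArg X hy1
  rw [Y.leibniz, Y.leibniz (μx - νx), ← hXY, hx0, map_zero] at hx2
  rw [X.leibniz, X.leibniz (μy - νy), hXY, hy0, map_zero] at hy2
  have hmnY : Y (m * n * (μy - νy)) = m * n * Y (μy - νy) + m * n * (μy + νy) * (μy - νy) := by
    simp only [Derivation.leibniz, smul_eq_mul, hm', hn']
    ring
  rw [map_sub Y, map_sub Y, hmnY] at hx2
  rw [map_sub X, map_sub X, map_sub X μx] at hy2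
  simp only [Derivation.leibniz, smul_eq_mul, map_sub, hm, hm', hn, hn', hμ, hν, hμ', hν',
    mul_zero, zero_add, add_zero] at hx2 hy2
  rw [map_sub] at hx1 hy1
  have hx3 : κ * (m - n) ^ 2 * (μx - νx) = 0 := by
    linear_combination -(m - n) * hx2 + (m * μy - n * νy) * hx1 + m * n * (μx - νx) * hy1
  have hy3 : κ * (m - n) ^ 2 * (μy - νy) = 0 := by
    linear_combination (m - n) * hy2 - (m * μx - n * νx) * hy1 - (μy - νy) * hx1
  constructor
  · linear_combination E * E * hx3 - κ * (μx - νx) * hEu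
  · linear_combination E * E * hy3 - κ * (μy - νy) * hEu

/-- If the cross-ratio `m / n` is constant, a solution `(s, t)` of the first order system describing
the abelian relations of the 4-web satisfies two first order equations. -/
theorem relation_derivatives (hXY : ∀ f, X (Y f) = Y (X f)) {m n E μx μy κ s t : R}
    (hm : X m = m * μx) (hm' : Y m = m * μy) (hn : X n = n * μx) (hn' : Y n = n * μy)
    (hE : E * (m - n) = 1) (hμ : X μy = κ) (hμ' : Y μx = κ)
    (hs : X s = 0) (ht : Y t = 0)
    (hst : X (E * (t - n * s)) = Y (m * (E * (t - n * s)))) :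
    4 * κ * (m * n) * Y s = (X κ - κ * μx) * t - m * n * (Y κ + 5 * κ * μy) * s ∧
    4 * κ * X t = (5 * κ * μx - X κ) * t + m * n * (Y κ + κ * μy) * s := by
  have hEX : X E = -(E * μx) := by
    have h := congrArg X hE
    simp only [Derivation.leibniz, map_sub, smul_eq_mul, Derivation.map_one_eq_zero, hm, hn] at h
    linear_combination E * h - X E * hE - E * μx * hE
  have hEY : Y E = -(E * μy) := by
    have h := congrArg Y hE
    simp only [Derivation.leibniz, map_sub, smul_eq_mul, Derivation.map_one_eq_zero, hm', hn'] at h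
    linear_combination E * h - Y E * hE - E * μy * hE
  have h1 : X t = μx * t - m * n * μy * s - m * n * Y s := by
    simp only [Derivation.leibniz, map_sub, smul_eq_mul, hn, hm', hn', hEX, hEY, hs, ht] at hst
    linear_combination (m - n) * hst - (X t - μx * t + m * n * μy * s + m * n * Y s) * hE
  -- Since `Y X t = X Y t = 0`, applying `Y` removes the left side. A further `X` annihilates `Y s`
  -- and `Y (Y s)`, so `Y (Y s)` survives in `h3` only with the factor `X (m n) = 2 m n μx`, which
  -- `2 μx h2` cancels.
  have h2 := congrArg Y h1
  rw [← hXY, ht, map_zero] at h2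
  simp only [Derivation.leibniz, map_sub, smul_eq_mul, hm', hn', hμ', ht] at h2
  have h3 := congrArg X h2
  have hys : X (Y s) = 0 := by rw [hXY, hs, map_zero]
  have hyys : X (Y (Y s)) = 0 := by rw [hXY, hys, map_zero]
  have hyμ : X (Y μy) = Y κ := by rw [hXY, hμ]
  simp only [Derivation.leibniz, map_sub, map_add, smul_eq_mul, hm, hn, hμ, hs, hys, hyys, hyμ,
    map_zero] at h3
  have h4 : 4 * κ * (m * n) * Y s = (X κ - κ * μx) * t - m * n * (Y κ + 5 * κ * μy) * s := by
    linear_combination h3 + κ * h1 - 2 * μx * h2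
  exact ⟨h4, by linear_combination 4 * κ * h1 - h4⟩

/-- If the cross-ratio is constant, two abelian relations have proportional coefficients, unless
the curvature `κ` is zero. -/
theorem relation_det_eq_zero [IsDomain R] [CharZero R] (hXY : ∀ f, X (Y f) = Y (X f))
    {m n μx μy κ s t s' t' : R}
    (hmn : IsUnit (m * n)) (hμ : X μy = κ) (hμ' : Y μx = κ) (hκ : κ ≠ 0)
    (hs : X s = 0) (ht : Y t = 0) (hs' : X s' = 0) (ht' : Y t' = 0)
    (h1 : 4 * κ * (m * n) * Y s = (X κ - κ * μx) * t - m * n * (Y κ + 5 * κ * μy) * s)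
    (h2 : 4 * κ * X t = (5 * κ * μx - X κ) * t + m * n * (Y κ + κ * μy) * s)
    (h1' : 4 * κ * (m * n) * Y s' = (X κ - κ * μx) * t' - m * n * (Y κ + 5 * κ * μy) * s')
    (h2' : 4 * κ * X t' = (5 * κ * μx - X κ) * t' + m * n * (Y κ + κ * μy) * s') :
    s * t' = s' * t := by
  rw [← sub_eq_zero]
  by_contra hδ
  set δ := s * t' - s' * t with hδ_def
  have hy : 4 * κ * Y δ = -(Y κ + 5 * κ * μy) * δ := by
    refine hmn.mul_left_cancel ?_
    simp only [hδ_def, Derivation.leibniz, map_sub, smul_eq_mul, ht, ht']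
    linear_combination t' * h1 - t * h1'
  have hx : 4 * κ * X δ = (5 * κ * μx - X κ) * δ := by
    simp only [hδ_def, Derivation.leibniz, map_sub, smul_eq_mul, hs, hs']
    linear_combination s * h2' - s' * h2
  have hxy := congrArg X hy
  have hyx := congrArg Y hx
  have h4 : ∀ D : Derivation k R R, D 4 = 0 := fun D => by
    have := D.map_natCast 4
    exact_mod_cast this
  have h5 : ∀ D : Derivation k R R, D 5 = 0 := fun D => by
    have := D.map_natCast 5
    exact_mod_cast this
  simp only [Derivation.leibniz, map_sub, map_add, map_neg, smul_eq_mul, hμ, hμ', h4, h5, hXY] at hxy hyx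
  -- Equality of the mixed derivatives of `δ`: with denominators cleared, the defect `(5/2) κ` of `d
  -- log δ` appears as `40 κ³ δ = 0`.
  have hfin : κ * κ * (κ * δ) = 0 := by
    have : (40 : R) * (κ * κ * (κ * δ)) = 0 := by
      linear_combination 4 * κ * (hxy - hyx) - (3 * X κ + 5 * κ * μx) * hy -
        (5 * κ * μy - 3 * Y κ) * hx
    exact (mul_eq_zero.1 this).resolve_left (by norm_num)
  exact (mul_ne_zero (mul_ne_zero hκ hκ) (mul_ne_zero hκ hδ)) hfin

end Derivations

/-! ### Abelian relations with proportional components -/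

theorem dForm_smul_dFun (f φ : Hol) : dForm (f • dFun φ) = wedge (dFun f) (dFun φ) := by
  simp only [dForm, wedge, dFun, Prod.smul_mk, smul_eq_mul, Derivation.leibniz, dx_dy]
  ring

theorem Web.isUnit_wedge {d : ℕ} (W : Web d) {i j : Fin d} (h : i ≠ j) :
    IsUnit (wedge (dFun (W.F i)) (dFun (W.F j))) :=
  Hol.isUnit_iff.2 (W.general_position i j h)

theorem Web.wedge_eq_zero {d : ℕ} {W : Web d} {G : Fin d → Hol} (hG : G ∈ W.abelianRelations)
    (i : Fin d) : wedge (dFun (G i)) (dFun (W.F i)) = 0 := by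
  obtain ⟨g, hg, h⟩ := hG.1 i
  exact wedge_dFun_eq_zero (W.F_zero i) hg h

/-- The common ratio `Gᵢ / Hᵢ = Gⱼ / Hⱼ` has differential proportional to both `dFᵢ` and `dFⱼ`, so
it is constant. This needs two nonzero components of `H`. -/
theorem Web.exists_smul_eq {d : ℕ} {W : Web d} {G H : Fin d → Hol} (hd : 2 ≤ d)
    (hG : G ∈ W.abelianRelations) (hH : H ∈ W.abelianRelations) (hH0 : H ≠ 0)
    (hGH : ∀ i j, G i * H j = G j * H i) : ∃ c : ℂ, G = c • H := by
  obtain ⟨i, hi⟩ := Function.ne_iff.1 hH0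
  rw [Pi.zero_apply] at hi
  -- A relation with a single nonzero component would read `Hᵢ dFᵢ = 0`, which wedging with another
  -- `dFⱼ` excludes.
  obtain ⟨j, hji, hj⟩ : ∃ j, j ≠ i ∧ H j ≠ 0 := by
    by_contra! hc
    have hs := hH.2
    rw [Finset.sum_eq_single i (fun j _ hj => by rw [hc j hj, zero_smul]) (by simp)] at hs
    have : Nontrivial (Fin d) := Fin.nontrivial_iff_two_le.2 hd
    obtain ⟨j, hj⟩ := exists_ne i
    refine hi ((W.isUnit_wedge hj.symm).mul_left_eq_zero.1 ?_)
    have h1 := congrArg Prod.fst hs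
    have h2 := congrArg Prod.snd hs
    simp only [Prod.smul_fst, Prod.smul_snd, smul_eq_mul, Prod.fst_zero, Prod.snd_zero] at h1 h2
    simp only [wedge]
    linear_combination (dFun (W.F j)).2 * h1 - (dFun (W.F j)).1 * h2
  have hij := hGH i j
  have w1 := Web.wedge_eq_zero hG i
  have w2 := Web.wedge_eq_zero hG j
  have w3 := Web.wedge_eq_zero hH i
  have w4 := Web.wedge_eq_zero hH j
  have hJ := W.isUnit_wedge hji
  simp only [wedge, dFun] at w1 w2 w3 w4 hJ
  have e1 := congrArg dx hij
  have e2 := congrArg dy hij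
  simp only [Derivation.leibniz, smul_eq_mul] at e1 e2
  have k1 : (G i * dx (H i) - H i * dx (G i)) * dy (W.F i) -
      (G i * dy (H i) - H i * dy (G i)) * dx (W.F i) = 0 := by
    linear_combination G i * w3 - H i * w1
  have kx : H j ^ 2 * (G i * dx (H i) - H i * dx (G i)) =
      H i ^ 2 * (G j * dx (H j) - H j * dx (G j)) := by
    linear_combination (-(H i) * H j) * e1 + (H j * dx (H i) + H i * dx (H j)) * hij
  have ky : H j ^ 2 * (G i * dy (H i) - H i * dy (G i)) =
      H i ^ 2 * (G j * dy (H j) - H j * dy (G j)) := by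
    linear_combination (-(H i) * H j) * e2 + (H j * dy (H i) + H i * dy (H j)) * hij
  have k2 : (G i * dx (H i) - H i * dx (G i)) * dy (W.F j) -
      (G i * dy (H i) - H i * dy (G i)) * dx (W.F j) = 0 := by
    refine (mul_eq_zero.1 (?_ : H j ^ 2 * _ = 0)).resolve_left (pow_ne_zero 2 hj)
    linear_combination dy (W.F j) * kx - dx (W.F j) * ky +
      H i ^ 2 * (G j * w4 - H j * w2)
  obtain ⟨c, hc⟩ := Hol.exists_smul_eq hi (φ := G i)
    (sub_eq_zero.1 (hJ.mul_left_eq_zero.1 (by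
      linear_combination dx (W.F j) * k1 - dx (W.F i) * k2)))
    (sub_eq_zero.1 (hJ.mul_left_eq_zero.1 (by
      linear_combination dy (W.F j) * k1 - dy (W.F i) * k2)))
  refine ⟨c, funext fun l => mul_right_cancel₀ hi ?_⟩
  rw [← hGH i l, hc, Pi.smul_apply, smul_mul_assoc, smul_mul_assoc, mul_comm]

/-! ### Frames -/

/-- The first derivation of the frame dual to `(dφ, dψ)`; `u` is the inverse of `dφ ∧ dψ`. -/
def frameX (ψ u : Hol) : Derivation ℂ Hol Hol := (u * dy ψ) • dx - (u * dx ψ) • dy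

/-- The second derivation of the frame dual to `(dφ, dψ)`; `u` is the inverse of `dφ ∧ dψ`. -/
def frameY (φ u : Hol) : Derivation ℂ Hol Hol := (u * dx φ) • dy - (u * dy φ) • dx

theorem frameX_apply (ψ u f : Hol) : frameX ψ u f = u * wedge (dFun f) (dFun ψ) := by
  simp only [frameX, wedge, dFun, Derivation.sub_apply, Derivation.smul_apply, smul_eq_mul]
  ring

theorem frameY_apply (φ u f : Hol) : frameY φ u f = u * wedge (dFun φ) (dFun f) := by
  simp only [frameY, wedge, dFun, Derivation.sub_apply, Derivation.smul_apply, smul_eq_mul]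
  ring

section Frame

variable {φ ψ u : Hol}

theorem oneForm_eq_frame (hu : u * wedge (dFun φ) (dFun ψ) = 1) (ω : OneForm) :
    ω = (u * wedge ω (dFun ψ)) • dFun φ + (u * wedge (dFun φ) ω) • dFun ψ := by
  simp only [wedge, dFun] at *
  ext1
  · simp only [Prod.fst_add, Prod.smul_fst, smul_eq_mul]
    linear_combination -ω.1 * hu
  · simp only [Prod.snd_add, Prod.smul_snd, smul_eq_mul]
    linear_combination -ω.2 * hu

theorem dFun_eq_frame (hu : u * wedge (dFun φ) (dFun ψ) = 1) (f : Hol) :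
    dFun f = frameX ψ u f • dFun φ + frameY φ u f • dFun ψ := by
  rw [frameX_apply, frameY_apply]
  exact oneForm_eq_frame hu _

theorem wedge_frame (a b a' b' : Hol) :
    wedge (a • dFun φ + b • dFun ψ) (a' • dFun φ + b' • dFun ψ) =
      (a * b' - b * a') * wedge (dFun φ) (dFun ψ) := by
  simp only [wedge, dFun, Prod.fst_add, Prod.snd_add, Prod.smul_fst, Prod.smul_snd, smul_eq_mul]
  ring

theorem dForm_add (α β : OneForm) : dForm (α + β) = dForm α + dForm β := by
  simp only [dForm, Prod.fst_add, Prod.snd_add, map_add]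
  ring

theorem dForm_frame (φ ψ u a b : Hol) :
    u * dForm (a • dFun φ + b • dFun ψ) = frameX ψ u b - frameY φ u a := by
  rw [dForm_add, dForm_smul_dFun, dForm_smul_dFun, frameX_apply, frameY_apply]
  simp only [wedge]
  ring

/-- The frame is dual to exact forms, so `d (df) = 0` written in it is the vanishing of the
commutator. -/
theorem frame_comm (hu : u * wedge (dFun φ) (dFun ψ) = 1) (f : Hol) :
    frameX ψ u (frameY φ u f) = frameY φ u (frameX ψ u f) := by
  rw [← sub_eq_zero, ← dForm_frame φ ψ, ← dFun_eq_frame hu]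
  simp [dForm, dFun, dx_dy]

theorem wedge_frame_eq_zero_iff (hu : u * wedge (dFun φ) (dFun ψ) = 1) (f g : Hol) :
    wedge (dFun f) (dFun g) = 0 ↔
      frameX ψ u f * frameY φ u g = frameY φ u f * frameX ψ u g := by
  rw [dFun_eq_frame hu f, dFun_eq_frame hu g, wedge_frame, ← sub_eq_zero (b := _ * _)]
  have hJ : IsUnit (wedge (dFun φ) (dFun ψ)) := IsUnit.of_mul_eq_one u (by rw [mul_comm, hu])
  exact hJ.mul_left_eq_zero

theorem smul_frame_sum_eq_zero (φ ψ u : Hol) {ι : Type*} [Fintype ι]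
    {ρ F : ι → Hol} (h : ∑ i, ρ i • dFun (F i) = 0) :
    ∑ i, ρ i * frameX ψ u (F i) = 0 ∧ ∑ i, ρ i * frameY φ u (F i) = 0 := by
  have h1 := congrArg Prod.fst h
  have h2 := congrArg Prod.snd h
  simp only [Prod.fst_sum, Prod.snd_sum, Prod.smul_fst, Prod.smul_snd, smul_eq_mul,
    Prod.fst_zero, Prod.snd_zero] at h1 h2
  constructor
  · have : ∑ i, ρ i * frameX ψ u (F i) = u * (dFun ψ).2 * ∑ i, ρ i * (dFun (F i)).1 -
        u * (dFun ψ).1 * ∑ i, ρ i * (dFun (F i)).2 := by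
      rw [Finset.mul_sum, Finset.mul_sum, ← Finset.sum_sub_distrib]
      refine Finset.sum_congr rfl fun i _ => ?_
      rw [frameX_apply, wedge]
      ring
    rw [this, h1, h2, mul_zero, mul_zero, sub_zero]
  · have : ∑ i, ρ i * frameY φ u (F i) = u * (dFun φ).1 * ∑ i, ρ i * (dFun (F i)).2 -
        u * (dFun φ).2 * ∑ i, ρ i * (dFun (F i)).1 := by
      rw [Finset.mul_sum, Finset.mul_sum, ← Finset.sum_sub_distrib]
      refine Finset.sum_congr rfl fun i _ => ?_
      rw [frameY_apply, wedge]
      ring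
    rw [this, h1, h2, mul_zero, mul_zero, sub_zero]

/-- The data defining a Blaschke curvature, written in a frame. -/
theorem Web.IsBlaschkeCurvature.exists_frame (hu : u * wedge (dFun φ) (dFun ψ) = 1) {W : Web 3}
    {K : Hol} (h : W.IsBlaschkeCurvature K) :
    ∃ (ρ : Fin 3 → Hol) (γ₀ γ₁ : Hol), (∀ i, IsUnit (ρ i)) ∧
      (∑ i, ρ i * frameX ψ u (W.F i) = 0 ∧ ∑ i, ρ i * frameY φ u (W.F i) = 0) ∧
      (∀ i, frameX ψ u (ρ i) * frameY φ u (W.F i) - frameY φ u (ρ i) * frameX ψ u (W.F i) =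
        ρ i * (γ₀ * frameY φ u (W.F i) - γ₁ * frameX ψ u (W.F i))) ∧
      frameX ψ u γ₁ - frameY φ u γ₀ = u * K := by
  obtain ⟨ρ, γ, hρ, hs, hd, rfl⟩ := h
  refine ⟨ρ, u * wedge γ (dFun ψ), u * wedge (dFun φ) γ, hρ, smul_frame_sum_eq_zero φ ψ u hs,
    fun i => ?_, ?_⟩
  · have h := hd i
    rw [dForm_smul_dFun, oneForm_eq_frame hu γ, dFun_eq_frame hu (ρ i),
      dFun_eq_frame hu (W.F i), smul_add, smul_smul, smul_smul, wedge_frame, wedge_frame] at h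
    have hJ : IsUnit (wedge (dFun φ) (dFun ψ)) := IsUnit.of_mul_eq_one u (by rw [mul_comm, hu])
    have := hJ.mul_right_cancel h
    linear_combination this
  · rw [← dForm_frame φ ψ, ← oneForm_eq_frame hu]

end Frame

/-! ### Blaschke curvatures of the extracted 3-webs in the frame -/

section Derivations

variable {k R : Type*} [CommRing k] [CommRing R] [Algebra k R] {X Y : Derivation k R R}

theorem exists_logDeriv (D : Derivation k R R) {u : R} (hu : IsUnit u) : ∃ α, D u = u * α := by
  obtain ⟨v, hv⟩ := hu.exists_right_inv
  exact ⟨v * D u, by rw [← mul_assoc, hv, one_mul]⟩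

/-- The Blaschke curvature of the 3-web of the frame and of a third foliation. -/
theorem curvature_of_frame (hXY : ∀ f, X (Y f) = Y (X f)) {m b μy ρ₀ ρ₁ ρ₂ γ₀ γ₁ κ : R}
    (hm : IsUnit m) (hm' : Y m = m * μy) (hρ₁ : IsUnit ρ₁) (h0 : ρ₀ + ρ₂ * (m * b) = 0)
    (h1 : ρ₁ + ρ₂ * b = 0) (e0 : Y ρ₀ = ρ₀ * γ₁) (e1 : X ρ₁ = ρ₁ * γ₀) (hκ : X γ₁ - Y γ₀ = κ) :
    X μy = κ := by
  obtain ⟨β, hβ⟩ := exists_logDeriv Y hρ₁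
  have hβ' := logDeriv_comm hXY hρ₁ e1 hβ
  have e : ρ₀ = m * ρ₁ := by linear_combination h0 - m * h1
  rw [e, Y.leibniz, hβ, hm'] at e0
  simp only [smul_eq_mul] at e0
  -- Here `γ₁ = Y log ρ₀` and `γ₀ = X log ρ₁` with `ρ₀ = m ρ₁`, so `dγ` only sees `XY log m`.
  have hγ : γ₁ = μy + β := by
    refine (hm.mul hρ₁).mul_left_cancel ?_
    linear_combination -e0
  rw [hγ, map_add, hβ'] at hκ
  linear_combination hκ

/-- The Blaschke curvature of the 3-web of the first leaves of the frame and of two other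
foliations. -/
theorem curvature_of_fst (hXY : ∀ f, X (Y f) = Y (X f))
    {m n E b b' μy νy ρ₂ ρ₃ γ₀ γ₁ κ : R} (hm' : Y m = m * μy) (hn' : Y n = n * νy)
    (hE : E * (m - n) = 1) (hb : IsUnit b) (hρ₂ : IsUnit ρ₂) (hbc : X b = Y (m * b))
    (hbc' : X b' = Y (n * b')) (h1 : ρ₂ * b + ρ₃ * b' = 0)
    (e2 : X ρ₂ * b - Y ρ₂ * (m * b) = ρ₂ * (γ₀ * b - γ₁ * (m * b)))
    (e3 : X ρ₃ * b' - Y ρ₃ * (n * b') = ρ₃ * (γ₀ * b' - γ₁ * (n * b')))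
    (hκ : X γ₁ - Y γ₀ = κ) :
    Y (E * (m * n * (μy - νy))) = X (E * (m * μy - n * νy)) - κ := by
  have hR : IsUnit (ρ₂ * b) := hρ₂.mul hb
  obtain ⟨α, hα⟩ := exists_logDeriv X hR
  obtain ⟨β, hβ⟩ := exists_logDeriv Y hR
  have hβ' := logDeriv_comm hXY hR hα hβ
  have hα3 := congrArg X h1
  have hβ3 := congrArg Y h1
  rw [map_add, hα, map_zero] at hα3
  rw [map_add, hβ, map_zero] at hβ3
  simp only [Derivation.leibniz, smul_eq_mul, hm', hn'] at hα hβ hα3 hβ3 hbc hbc'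
  -- The condition `dω = γ ∧ ω` for each of the two leaves off the frame is linear in `(γ₀, γ₁)`;
  -- the 2×2 system has determinant `m - n` up to sign, with inverse given by `E`. The common part
  -- `(α, β)` is `d log (ρ₂ b)`, which is closed and does not contribute to `κ`.
  have k2 : α - m * β - m * μy = γ₀ - m * γ₁ := by
    refine hR.mul_left_cancel ?_
    linear_combination e2 - hα + m * hβ + ρ₂ * hbc
  have k3 : α - n * β - n * νy = γ₀ - n * γ₁ := by
    refine hR.mul_left_cancel ?_
    linear_combination -e3 + hα3 - n * hβ3 - ρ₃ * hbc' - (γ₀ - n * γ₁ + n * νy) * h1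
  have hγ1 : γ₁ = β + E * (m * μy - n * νy) := by
    linear_combination E * (k2 - k3) + (β - γ₁) * hE
  have hγ0 : γ₀ = α + E * (m * n * (μy - νy)) := by
    linear_combination -k2 + m * hγ1 + m * μy * hE
  rw [hγ1, hγ0, map_add, map_add, hβ'] at hκ
  linear_combination -hκ

/-- The Blaschke curvature of the 3-web of the second leaves of the frame and of two other
foliations. -/
theorem curvature_of_snd (hXY : ∀ f, X (Y f) = Y (X f))
    {m n E b b' μx νx ρ₂ ρ₃ γ₀ γ₁ κ : R} (hm : X m = m * μx) (hn : X n = n * νx)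
    (hmu : IsUnit m) (hμ : Y μx = κ) (hν : Y νx = κ)
    (hE : E * (m - n) = 1) (hb : IsUnit b) (hρ₂ : IsUnit ρ₂) (hbc : X b = Y (m * b))
    (hbc' : X b' = Y (n * b')) (h1 : ρ₂ * (m * b) + ρ₃ * (n * b') = 0)
    (e2 : X ρ₂ * b - Y ρ₂ * (m * b) = ρ₂ * (γ₀ * b - γ₁ * (m * b)))
    (e3 : X ρ₃ * b' - Y ρ₃ * (n * b') = ρ₃ * (γ₀ * b' - γ₁ * (n * b')))
    (hκ : X γ₁ - Y γ₀ = κ) :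
    X (E * (μx - νx)) = Y (E * (m * μx - n * νx)) - κ := by
  have hR : IsUnit (ρ₂ * (m * b)) := hρ₂.mul (hmu.mul hb)
  obtain ⟨α, hα⟩ := exists_logDeriv X hR
  obtain ⟨β, hβ⟩ := exists_logDeriv Y hR
  have hβ' := logDeriv_comm hXY hR hα hβ
  have hα3 := congrArg X h1
  have hβ3 := congrArg Y h1
  rw [map_add, hα, map_zero] at hα3
  rw [map_add, hβ, map_zero] at hβ3
  rw [Y.leibniz] at hβ hβ3
  rw [← hbc] at hβ
  rw [← hbc'] at hβ3
  simp only [Derivation.leibniz, smul_eq_mul, hm, hn] at hα hβ hα3 hβ3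
  have k2 : α - μx - m * β = γ₀ - m * γ₁ := by
    refine hR.mul_left_cancel ?_
    linear_combination m * e2 - hα + m * hβ
  -- The reference unit is now `ρ₂ m b`, the `dF₀`-coefficient, because leaf `1` contributes nothing
  -- in that direction.
  have k3 : α - νx - n * β = γ₀ - n * γ₁ := by
    refine hR.mul_left_cancel ?_
    linear_combination -n * e3 + hα3 - n * hβ3 - (γ₀ - n * γ₁ + νx) * h1
  have hγ1 : γ₁ = β + E * (μx - νx) := by
    linear_combination E * (k2 - k3) + (β - γ₁) * hE
  have hγ0 : γ₀ = α + E * (m * μx - n * νx) - (μx + νx) := by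
    linear_combination -k2 + m * hγ1 - νx * hE
  rw [hγ1, hγ0, map_add, map_sub, map_add, map_add, hβ', hμ, hν] at hκ
  linear_combination hκ

end Derivations

/-! ### Equal nonzero Blaschke curvatures -/

theorem Web.rank_le_one_of_curvature (W : Web 4) {K : Hol} (hK : K ≠ 0)
    (h : ∀ k, (W.extract k).IsBlaschkeCurvature K) : W.rank ≤ 1 := by
  have hJ := W.isUnit_wedge (i := 0) (j := 1) (by decide)
  obtain ⟨u, hu⟩ := hJ.exists_left_inv
  have huu : IsUnit u := IsUnit.of_mul_eq_one _ hu
  have hXY := fun f => frame_comm hu f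
  have hX0 : frameX (W.F 1) u (W.F 0) = 1 := by rw [frameX_apply, hu]
  have hX1 : frameX (W.F 1) u (W.F 1) = 0 := by rw [frameX_apply, wedge]; ring
  have hY0 : frameY (W.F 0) u (W.F 0) = 0 := by rw [frameY_apply, wedge]; ring
  have hY1 : frameY (W.F 0) u (W.F 1) = 1 := by rw [frameY_apply, hu]
  have ha : ∀ i, i ≠ 1 → IsUnit (frameX (W.F 1) u (W.F i)) := fun i hi => by
    rw [frameX_apply]; exact huu.mul (W.isUnit_wedge hi)
  have hb : ∀ i, i ≠ 0 → IsUnit (frameY (W.F 0) u (W.F i)) := fun i hi => by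
    rw [frameY_apply]; exact huu.mul (W.isUnit_wedge hi.symm)
  have hw : IsUnit (frameX (W.F 1) u (W.F 2) * frameY (W.F 0) u (W.F 3) -
      frameY (W.F 0) u (W.F 2) * frameX (W.F 1) u (W.F 3)) := by
    have h1 := W.isUnit_wedge (i := 2) (j := 3) (by decide)
    rw [dFun_eq_frame hu (W.F 2), dFun_eq_frame hu (W.F 3), wedge_frame] at h1
    exact isUnit_of_mul_isUnit_left h1
  have hwedge := fun f g => (wedge_frame_eq_zero_iff hu f g).1
  have hcurv := fun k => (h k).exists_frame hu
  have hrel : ∀ G ∈ W.abelianRelations,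
      (∑ i, G i * frameX (W.F 1) u (W.F i) = 0 ∧ ∑ i, G i * frameY (W.F 0) u (W.F i) = 0) :=
    fun G hG => smul_frame_sum_eq_zero _ _ _ hG.2
  set X := frameX (W.F 1) u
  set Y := frameY (W.F 0) u
  clear_value X Y
  obtain ⟨c₂, hc₂⟩ := (hb 2 (by decide)).exists_left_inv
  obtain ⟨c₃, hc₃⟩ := (hb 3 (by decide)).exists_left_inv
  have hb2 := hb 2 (by decide)
  have ha2 := ha 2 (by decide)
  have ha3 := ha 3 (by decide)
  have hcl : ∀ i, X (Y (W.F i)) = Y (X (W.F i)) := fun i => hXY _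
  have hm_eq : X (W.F 2) = (X (W.F 2) * c₂) * Y (W.F 2) := by
    rw [mul_assoc, hc₂, mul_one]
  have hn_eq : X (W.F 3) = (X (W.F 3) * c₃) * Y (W.F 3) := by
    rw [mul_assoc, hc₃, mul_one]
  have hmu : IsUnit (X (W.F 2) * c₂) := ha2.mul (IsUnit.of_mul_eq_one _ hc₂)
  have hnu : IsUnit (X (W.F 3) * c₃) := ha3.mul (IsUnit.of_mul_eq_one _ hc₃)
  generalize X (W.F 2) * c₂ = m at hm_eq hmu
  generalize X (W.F 3) * c₃ = n at hn_eq hnu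
  obtain ⟨E, hE⟩ : ∃ E, E * (m - n) = 1 := by
    have : IsUnit (m - n) := by
      refine isUnit_of_mul_isUnit_left (y := Y (W.F 2) * Y (W.F 3)) ?_
      convert hw using 1
      rw [hm_eq, hn_eq]
      ring
    exact this.exists_left_inv
  obtain ⟨μx, hμx⟩ := exists_logDeriv X hmu
  obtain ⟨μy, hμy⟩ := exists_logDeriv Y hmu
  obtain ⟨νx, hνx⟩ := exists_logDeriv X hnu
  obtain ⟨νy, hνy⟩ := exists_logDeriv Y hnu
  have hμc := logDeriv_comm hXY hmu hμx hμy
  have hνc := logDeriv_comm hXY hnu hνx hνy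
  have hκ0 : u * K ≠ 0 := mul_ne_zero huu.ne_zero hK
  generalize u * K = κ at hcurv hκ0
  have i30 : (W.extract 3).F 0 = W.F 0 := rfl
  have i31 : (W.extract 3).F 1 = W.F 1 := rfl
  have i32 : (W.extract 3).F 2 = W.F 2 := rfl
  have i20 : (W.extract 2).F 0 = W.F 0 := rfl
  have i21 : (W.extract 2).F 1 = W.F 1 := rfl
  have i22 : (W.extract 2).F 2 = W.F 3 := rfl
  have i10 : (W.extract 1).F 0 = W.F 0 := rfl
  have i11 : (W.extract 1).F 1 = W.F 2 := rfl
  have i12 : (W.extract 1).F 2 = W.F 3 := rfl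
  have i00 : (W.extract 0).F 0 = W.F 1 := rfl
  have i01 : (W.extract 0).F 1 = W.F 2 := rfl
  have i02 : (W.extract 0).F 2 = W.F 3 := rfl
  -- The webs omitting leaves `3` and `2` contain the whole frame and give the curvatures of `m` and
  -- `n`; those omitting `1` and `0` give `hB` and `hC`.
  have hμ : X μy = κ := by
    obtain ⟨ρ, γ₀, γ₁, hρ, ⟨h0, h1⟩, e, hk⟩ := hcurv 3
    have e0 := e 0
    have e1 := e 1
    simp only [Fin.sum_univ_three, i30, i31, i32, hX0, hX1, hY0, hY1] at h0 h1 e0 e1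
    refine curvature_of_frame hXY hmu hμy (hρ 1) (b := Y (W.F 2)) (ρ₀ := ρ 0) (ρ₂ := ρ 2) ?_ ?_ ?_ ?_ hk
    · rw [← hm_eq]; linear_combination h0
    · linear_combination h1
    · linear_combination -e0
    · linear_combination e1
  have hν : X νy = κ := by
    obtain ⟨ρ, γ₀, γ₁, hρ, ⟨h0, h1⟩, e, hk⟩ := hcurv 2
    have e0 := e 0
    have e1 := e 1
    simp only [Fin.sum_univ_three, i20, i21, i22, hX0, hX1, hY0, hY1] at h0 h1 e0 e1
    refine curvature_of_frame hXY hnu hνy (hρ 1) (b := Y (W.F 3)) (ρ₀ := ρ 0) (ρ₂ := ρ 2) ?_ ?_ ?_ ?_ hk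
    · rw [← hn_eq]; linear_combination h0
    · linear_combination h1
    · linear_combination -e0
    · linear_combination e1
  have hμ' : Y μx = κ := by rw [← hμc, hμ]
  have hν' : Y νx = κ := by rw [← hνc, hν]
  have hB : Y (E * (m * n * (μy - νy))) = X (E * (m * μy - n * νy)) - κ := by
    obtain ⟨ρ, γ₀, γ₁, hρ, ⟨h0, h1⟩, e, hk⟩ := hcurv 1
    have e1 := e 1
    have e2 := e 2
    simp only [Fin.sum_univ_three, i10, i11, i12, hX0, hY0] at h0 h1 e1 e2
    rw [hm_eq] at e1
    rw [hn_eq] at e2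
    refine curvature_of_fst hXY hμy hνy hE hb2 (hρ 1) (by rw [← hm_eq, hcl])
      (by rw [← hn_eq, hcl]) ?_ e1 e2 hk
    linear_combination h1
  have hC : X (E * (μx - νx)) = Y (E * (m * μx - n * νx)) - κ := by
    obtain ⟨ρ, γ₀, γ₁, hρ, ⟨h0, h1⟩, e, hk⟩ := hcurv 0
    have e1 := e 1
    have e2 := e 2
    simp only [Fin.sum_univ_three, i00, i01, i02, hX1, hY1] at h0 h1 e1 e2
    rw [hm_eq] at e1
    rw [hn_eq] at e2
    refine curvature_of_snd hXY hμx hνx hmu hμ' hν' hE hb2 (hρ 1) (by rw [← hm_eq, hcl])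
      (by rw [← hn_eq, hcl]) ?_ e1 e2 hk
    rw [← hm_eq, ← hn_eq]
    linear_combination h0
  obtain ⟨hx, hy⟩ := curvature_mul_crossRatio_eq_zero hXY hμx hμy hνx hνy (hmu.mul hnu) hE hμ hμ'
    hν hν' hB hC
  obtain rfl : μx = νx := sub_eq_zero.1 ((mul_eq_zero.1 hx).resolve_left hκ0)
  obtain rfl : μy = νy := sub_eq_zero.1 ((mul_eq_zero.1 hy).resolve_left hκ0)
  -- The two scalar equations of the relation are solved for `G 2` and `G 3`; the last clause is
  -- closedness of `G₂ dF₂`, in the form required by `relation_derivatives` with `s = -G 1` and `t =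
  -- -G 0`.
  have key : ∀ G ∈ W.abelianRelations, X (G 1) = 0 ∧ Y (G 0) = 0 ∧
      (Y (W.F 2) * G 2 = E * (n * G 1 - G 0) ∧ Y (W.F 3) * G 3 = E * (G 0 - m * G 1)) ∧
      X (E * (-G 0 - n * -G 1)) = Y (m * (E * (-G 0 - n * -G 1))) := by
    intro G hG
    obtain ⟨h0, h1⟩ := hrel G hG
    simp only [Fin.sum_univ_four, hX0, hX1, hY0, hY1] at h0 h1
    have w0 := hwedge _ _ (Web.wedge_eq_zero hG 0)
    have w1 := hwedge _ _ (Web.wedge_eq_zero hG 1)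
    have w2 := hwedge _ _ (Web.wedge_eq_zero hG 2)
    rw [hX0, hY0] at w0
    rw [hX1, hY1] at w1
    have hr : Y (W.F 2) * G 2 = E * (n * G 1 - G 0) := by
      linear_combination E * h0 - n * E * h1 - E * G 2 * hm_eq - E * G 3 * hn_eq -
        Y (W.F 2) * G 2 * hE
    refine ⟨by linear_combination w1, by linear_combination -w0, ⟨hr, ?_⟩, ?_⟩
    · linear_combination -E * h0 + m * E * h1 + E * G 2 * hm_eq + E * G 3 * hn_eq -
        Y (W.F 3) * G 3 * hE
    · have e : E * (-G 0 - n * -G 1) = G 2 * Y (W.F 2) := by linear_combination -hr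
      rw [e, show m * (G 2 * Y (W.F 2)) = G 2 * X (W.F 2) by rw [hm_eq]; ring, X.leibniz,
        Y.leibniz, hcl]
      simp only [smul_eq_mul]
      linear_combination w2
  have hdet : ∀ G ∈ W.abelianRelations, ∀ H ∈ W.abelianRelations, ∀ i j,
      G i * H j = G j * H i := by
    intro G hG H hH
    obtain ⟨g1, g0, ⟨g2, g3⟩, g⟩ := key G hG
    obtain ⟨k1, k0, ⟨k2, k3⟩, k⟩ := key H hH
    have s1 : ∀ G : Fin 4 → Hol, X (G 1) = 0 → X (-G 1) = 0 := fun G h => by rw [map_neg, h, neg_zero]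
    have s0 : ∀ G : Fin 4 → Hol, Y (G 0) = 0 → Y (-G 0) = 0 := fun G h => by rw [map_neg, h, neg_zero]
    obtain ⟨r1, r2⟩ := relation_derivatives hXY hμx hμy hνx hνy hE hμ hμ' (s1 G g1) (s0 G g0) g
    obtain ⟨q1, q2⟩ := relation_derivatives hXY hμx hμy hνx hνy hE hμ hμ' (s1 H k1) (s0 H k0) k
    have hd := relation_det_eq_zero hXY (hmu.mul hnu) hμ hμ' hκ0 (s1 G g1) (s0 G g0) (s1 H k1)
      (s0 H k0) r1 r2 q1 q2
    have hd' : G 1 * H 0 = G 0 * H 1 := by linear_combination hd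
    -- The same coefficients serve `G` and `H`, so the vanishing of one 2×2 minor implies that of
    -- all of them.
    have hcomb : ∀ i, ∃ α β, G i = α * G 1 + β * G 0 ∧ H i = α * H 1 + β * H 0 := by
      intro i
      fin_cases i
      · exact ⟨0, 1, by simp, by simp⟩
      · exact ⟨1, 0, by simp, by simp⟩
      · change ∃ α β, G 2 = α * G 1 + β * G 0 ∧ H 2 = α * H 1 + β * H 0
        exact ⟨c₂ * E * n, -c₂ * E, by linear_combination c₂ * g2 - G 2 * hc₂,
          by linear_combination c₂ * k2 - H 2 * hc₂⟩
      · change ∃ α β, G 3 = α * G 1 + β * G 0 ∧ H 3 = α * H 1 + β * H 0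
        exact ⟨-c₃ * E * m, c₃ * E, by linear_combination c₃ * g3 - G 3 * hc₃,
          by linear_combination c₃ * k3 - H 3 * hc₃⟩
    intro i j
    obtain ⟨α, β, e1, e2⟩ := hcomb i
    obtain ⟨α', β', e3, e4⟩ := hcomb j
    rw [e1, e2, e3, e4]
    linear_combination (α * β' - α' * β) * hd'
  have : Module.Free ℂ W.abelianRelations := Module.Free.of_divisionRing _ _
  rw [Web.rank, rank_le_one_iff]
  by_cases hne : ∃ H : W.abelianRelations, H ≠ 0
  · obtain ⟨H, hH⟩ := hne
    refine ⟨H, fun G => ?_⟩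
    obtain ⟨c, hc⟩ := Web.exists_smul_eq (by norm_num) G.2 H.2 (fun e => hH (Subtype.ext e))
      (hdet G.1 G.2 H.1 H.2)
    exact ⟨c, Subtype.ext hc.symm⟩
  · push Not at hne
    exact ⟨0, fun G => ⟨0, by rw [hne G, smul_zero]⟩⟩

/-! ### Slopes and the derivatives of a presentation -/

namespace Web.IsPresentedBy

variable {W : Web 4} {P : Hol[X]} (h : W.IsPresentedBy P)
include h

theorem dy_mul_slope (i : Fin 4) : dy (W.F i) * W.slope i = -dx (W.F i) := by
  have := Ring.mul_inverse_cancel _ (h.isUnit_dy i)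
  rw [Web.slope]
  linear_combination -dx (W.F i) * this

theorem isUnit_slope_sub {i j : Fin 4} (hij : i ≠ j) : IsUnit (W.slope i - W.slope j) := by
  have hw := W.isUnit_wedge hij
  refine isUnit_of_mul_isUnit_right (x := -(dy (W.F i) * dy (W.F j))) ?_
  convert hw using 1
  simp only [wedge, dFun]
  linear_combination -dy (W.F j) * h.dy_mul_slope i + dy (W.F i) * h.dy_mul_slope j

theorem slope_injective : Function.Injective W.slope := fun i j hij => by
  by_contra hne
  exact (h.isUnit_slope_sub hne).ne_zero (sub_eq_zero.2 hij)

/-- General position makes the four slopes distinct, and `P` has degree four over a domain. -/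
theorem roots_eq : P.roots = Finset.univ.val.map W.slope := by
  have hP : P ≠ 0 := fun h0 => by simpa [h0] using h.natDegree_eq
  symm
  refine Multiset.eq_of_le_of_card_le ?_ ?_
  · rw [Multiset.le_iff_subset (Finset.univ.nodup.map h.slope_injective)]
    intro x hx
    obtain ⟨i, -, rfl⟩ := Multiset.mem_map.1 hx
    exact (mem_roots hP).2 (h.isRoot i)
  · refine (card_roots' P).trans ?_
    rw [h.natDegree_eq]
    simp

theorem eq_prod : P = C P.leadingCoeff * ∏ i, (X - C (W.slope i)) := by
  have := C_leadingCoeff_mul_prod_multiset_X_sub_C (p := P) (by rw [h.roots_eq, h.natDegree_eq]; simp)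
  rw [h.roots_eq, Multiset.map_map] at this
  exact this.symm

/-- The resultant is a power of the leading coefficient times the product of `∂_p P` over the roots;
it is a unit, hence so is each factor. -/
theorem isUnit_sheetDeriv (i : Fin 4) : IsUnit (W.sheetDeriv P i) := by
  have hs : P.Splits := splits_iff_card_roots.2 (by rw [h.roots_eq, h.natDegree_eq]; simp)
  have hr := resultant_eq_prod_eval P (derivative P) _ le_rfl hs
  have hu := Hol.isUnit_iff.2 h.resultant_ne
  rw [hr, h.roots_eq, Multiset.map_map] at hu
  have hu2 := isUnit_of_mul_isUnit_right hu
  exact isUnit_of_dvd_unit (Finset.dvd_prod_of_mem _ (Finset.mem_univ i)) hu2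

/-- The inverse of `∂_p P` on a sheet. -/
theorem sheetDeriv_mul_inverse (i : Fin 4) :
    W.sheetDeriv P i * Ring.inverse (W.sheetDeriv P i) = 1 :=
  Ring.mul_inverse_cancel _ (h.isUnit_sheetDeriv i)

theorem sheetDeriv_eq :
    W.sheetDeriv P 0 = P.leadingCoeff * ((W.slope 0 - W.slope 1) * (W.slope 0 - W.slope 2) *
      (W.slope 0 - W.slope 3)) ∧
    W.sheetDeriv P 1 = P.leadingCoeff * ((W.slope 1 - W.slope 0) * (W.slope 1 - W.slope 2) *
      (W.slope 1 - W.slope 3)) ∧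
    W.sheetDeriv P 2 = P.leadingCoeff * ((W.slope 2 - W.slope 0) * (W.slope 2 - W.slope 1) *
      (W.slope 2 - W.slope 3)) ∧
    W.sheetDeriv P 3 = P.leadingCoeff * ((W.slope 3 - W.slope 0) * (W.slope 3 - W.slope 1) *
      (W.slope 3 - W.slope 2)) := by
  have e := h.eq_prod
  rw [Fin.prod_univ_four] at e
  have hd : ∀ x, (derivative P).eval x = P.leadingCoeff *
      (((x - W.slope 1) * (x - W.slope 2) * (x - W.slope 3)) +
        ((x - W.slope 0) * (x - W.slope 2) * (x - W.slope 3)) +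
        ((x - W.slope 0) * (x - W.slope 1) * (x - W.slope 3)) +
        ((x - W.slope 0) * (x - W.slope 1) * (x - W.slope 2))) := by
    intro x
    conv_lhs => rw [e]
    simp only [derivative_mul, derivative_C, derivative_sub, derivative_X, eval_mul, eval_add,
      eval_sub, eval_C, eval_X, eval_zero, eval_one]
    ring
  simp only [Web.sheetDeriv, hd]
  refine ⟨by ring, by ring, by ring, by ring⟩

/-- Euler's identities, before division by the Vandermonde determinant. -/
theorem sum_slope_pow_mul_inverse_aux (k : ℕ) :
    P.leadingCoeff * ((W.slope 0 - W.slope 1) * (W.slope 0 - W.slope 2) *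
      (W.slope 0 - W.slope 3) * ((W.slope 1 - W.slope 2) * (W.slope 1 - W.slope 3) *
      (W.slope 2 - W.slope 3))) * ∑ i, W.slope i ^ k * Ring.inverse (W.sheetDeriv P i) =
    (W.slope 1 - W.slope 2) * (W.slope 1 - W.slope 3) * (W.slope 2 - W.slope 3) * W.slope 0 ^ k -
    (W.slope 0 - W.slope 2) * (W.slope 0 - W.slope 3) * (W.slope 2 - W.slope 3) * W.slope 1 ^ k +
    (W.slope 0 - W.slope 1) * (W.slope 0 - W.slope 3) * (W.slope 1 - W.slope 3) * W.slope 2 ^ k -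
    (W.slope 0 - W.slope 1) * (W.slope 0 - W.slope 2) * (W.slope 1 - W.slope 2) * W.slope 3 ^ k := by
  obtain ⟨e0, e1, e2, e3⟩ := h.sheetDeriv_eq
  have i0 := h.sheetDeriv_mul_inverse 0
  have i1 := h.sheetDeriv_mul_inverse 1
  have i2 := h.sheetDeriv_mul_inverse 2
  have i3 := h.sheetDeriv_mul_inverse 3
  rw [Fin.sum_univ_four]
  generalize W.sheetDeriv P 0 = d0, W.sheetDeriv P 1 = d1, W.sheetDeriv P 2 = d2,
    W.sheetDeriv P 3 = d3 at e0 e1 e2 e3 i0 i1 i2 i3 ⊢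
  generalize Ring.inverse d0 = q0, Ring.inverse d1 = q1, Ring.inverse d2 = q2,
    Ring.inverse d3 = q3 at i0 i1 i2 i3 ⊢
  generalize W.slope 0 = p0, W.slope 1 = p1, W.slope 2 = p2, W.slope 3 = p3 at e0 e1 e2 e3 ⊢
  subst e0 e1 e2 e3
  linear_combination (p1 - p2) * (p1 - p3) * (p2 - p3) * p0 ^ k * i0 -
    (p0 - p2) * (p0 - p3) * (p2 - p3) * p1 ^ k * i1 +
    (p0 - p1) * (p0 - p3) * (p1 - p3) * p2 ^ k * i2 -
    (p0 - p1) * (p0 - p2) * (p1 - p2) * p3 ^ k * i3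

theorem vandermonde_ne_zero : (W.slope 0 - W.slope 1) * (W.slope 0 - W.slope 2) *
    (W.slope 0 - W.slope 3) * ((W.slope 1 - W.slope 2) * (W.slope 1 - W.slope 3) *
      (W.slope 2 - W.slope 3)) ≠ 0 := by
  have hu : ∀ i j : Fin 4, i ≠ j → W.slope i - W.slope j ≠ 0 := fun i j hij =>
    (h.isUnit_slope_sub hij).ne_zero
  exact mul_ne_zero (mul_ne_zero (mul_ne_zero (hu 0 1 (by decide)) (hu 0 2 (by decide)))
    (hu 0 3 (by decide))) (mul_ne_zero (mul_ne_zero (hu 1 2 (by decide)) (hu 1 3 (by decide)))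
    (hu 2 3 (by decide)))

/-- Euler's identities. -/
theorem sum_slope_pow_mul_inverse (k : ℕ) (hk : k < 3) :
    ∑ i, W.slope i ^ k * Ring.inverse (W.sheetDeriv P i) = 0 := by
  have hP : P.leadingCoeff ≠ 0 := leadingCoeff_ne_zero.2 fun h0 => by
    simpa [h0] using h.natDegree_eq
  refine (mul_eq_zero.1 ?_).resolve_left (mul_ne_zero hP h.vandermonde_ne_zero)
  rw [h.sum_slope_pow_mul_inverse_aux]
  interval_cases k <;> ring

theorem sum_slope_cube_mul_inverse_ne_zero :
    ∑ i, W.slope i ^ 3 * Ring.inverse (W.sheetDeriv P i) ≠ 0 := by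
  intro hs
  have ha := h.sum_slope_pow_mul_inverse_aux 3
  rw [hs, mul_zero] at ha
  refine h.vandermonde_ne_zero ?_
  linear_combination -ha

/-! ### The system `ℳ(4)` -/

/-- The interpolating cubic has no `p³` term. Divided by `qᵢ` and summed over the sheets, the
interpolated values give derivatives of Euler sums `∑ pᵢᵏ / qᵢ` with `k < 3`, hence `0`; on the
interpolation side only the cubic term survives, with nonzero factor `∑ pᵢ³ / qᵢ`. -/
theorem closednessTerm_eq (i : Fin 4) (l : Fin 2) :
    W.closednessTerm P i l = W.systemCoeff P 0 l + W.slope i * W.systemCoeff P 1 l +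
      W.slope i ^ 2 * W.systemCoeff P 2 l := by
  set V := Matrix.vandermonde W.slope with hV
  set S := V⁻¹ * Matrix.of (W.closednessTerm P) with hS
  have hdet : IsUnit V.det := by
    rw [hV, Matrix.det_vandermonde]
    refine (Finset.prod_induction _ IsUnit (fun _ _ => IsUnit.mul) isUnit_one fun i _ =>
      Finset.prod_induction _ IsUnit (fun _ _ => IsUnit.mul) isUnit_one fun j hj => ?_)
    exact h.isUnit_slope_sub (Finset.mem_Ioi.1 hj).ne'
  have hVS : V * S = Matrix.of (W.closednessTerm P) := Matrix.mul_nonsing_inv_cancel_left _ _ hdet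
  have hrow : ∀ i, W.closednessTerm P i l = W.systemCoeff P 0 l + W.slope i * W.systemCoeff P 1 l +
      W.slope i ^ 2 * W.systemCoeff P 2 l + W.slope i ^ 3 * S 3 l := by
    intro i
    have := congrFun (congrFun hVS i) l
    rw [Matrix.mul_apply, Fin.sum_univ_four] at this
    simp only [hV, Matrix.vandermonde_apply, Matrix.of_apply] at this
    rw [← this]
    simp only [Web.systemCoeff, hS, hV]
    simp
  have hq : ∀ i, Ring.inverse (W.sheetDeriv P i) * W.closednessTerm P i l =
      dx (W.slope i ^ (1 - (l : ℕ)) * Ring.inverse (W.sheetDeriv P i)) +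
        dy (W.slope i ^ (1 - (l : ℕ) + 1) * Ring.inverse (W.sheetDeriv P i)) := by
    intro i
    rw [Web.closednessTerm]
    linear_combination (dx (W.slope i ^ (1 - (l : ℕ)) * Ring.inverse (W.sheetDeriv P i)) +
      dy (W.slope i ^ (1 - (l : ℕ) + 1) * Ring.inverse (W.sheetDeriv P i))) *
        h.sheetDeriv_mul_inverse i
  have hl : (l : ℕ) ≤ 1 := by omega
  have hsum : ∑ i, Ring.inverse (W.sheetDeriv P i) * W.closednessTerm P i l = 0 := by
    simp only [hq]
    rw [Finset.sum_add_distrib, ← map_sum, ← map_sum, h.sum_slope_pow_mul_inverse _ (by omega),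
      h.sum_slope_pow_mul_inverse _ (by omega), map_zero, map_zero, add_zero]
  have h3 : (∑ i, W.slope i ^ 3 * Ring.inverse (W.sheetDeriv P i)) * S 3 l = 0 := by
    have k0 := h.sum_slope_pow_mul_inverse 0 (by norm_num)
    have k1 := h.sum_slope_pow_mul_inverse 1 (by norm_num)
    have k2 := h.sum_slope_pow_mul_inverse 2 (by norm_num)
    simp only [hrow] at hsum
    simp only [Fin.sum_univ_four] at *
    linear_combination hsum - W.systemCoeff P 0 l * k0 - W.systemCoeff P 1 l * k1 -
      W.systemCoeff P 2 l * k2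
  rw [hrow, (mul_eq_zero.1 h3).resolve_left h.sum_slope_cube_mul_inverse_ne_zero, mul_zero,
    add_zero]

end Web.IsPresentedBy

/-- `(b₀, b₁)` is a solution of the differential system with coefficients `A`. -/
structure IsSolution (A : Fin 3 → Fin 2 → Hol) (b₀ b₁ : Hol) : Prop where
  eq0 : dx b₁ + (A 0 0 * b₀ + A 0 1 * b₁) = 0
  eq1 : dx b₀ + dy b₁ + (A 1 0 * b₀ + A 1 1 * b₁) = 0
  eq2 : dy b₀ + (A 2 0 * b₀ + A 2 1 * b₁) = 0

/-! ### Abelian relations as solutions of the system `ℳ(4)` -/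

namespace Web.IsPresentedBy

variable {W : Web 4} {P : Hol[X]} (h : W.IsPresentedBy P)
include h

/-- Multiplied by `q`, closedness on a sheet is the value at the slope of a quadratic in `p` whose
coefficients are the three equations. Vanishing at three distinct slopes kills all coefficients. -/
theorem isSolution_iff (b₀ b₁ : Hol) : IsSolution (W.systemCoeff P) b₀ b₁ ↔
    ∀ i, dx ((b₀ * W.slope i + b₁) * Ring.inverse (W.sheetDeriv P i)) +
      dy (W.slope i * ((b₀ * W.slope i + b₁) * Ring.inverse (W.sheetDeriv P i))) = 0 := by
  set A := W.systemCoeff P with hA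
  have key : ∀ i, W.sheetDeriv P i *
      (dx ((b₀ * W.slope i + b₁) * Ring.inverse (W.sheetDeriv P i)) +
        dy (W.slope i * ((b₀ * W.slope i + b₁) * Ring.inverse (W.sheetDeriv P i)))) =
      (dx b₁ + (A 0 0 * b₀ + A 0 1 * b₁)) +
        W.slope i * (dx b₀ + dy b₁ + (A 1 0 * b₀ + A 1 1 * b₁)) +
        W.slope i ^ 2 * (dy b₀ + (A 2 0 * b₀ + A 2 1 * b₁)) := by
    intro i
    have c0 := h.closednessTerm_eq i 0
    have c1 := h.closednessTerm_eq i 1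
    simp only [← hA, Web.closednessTerm, Fin.val_zero, Fin.val_one, Nat.sub_zero, Nat.sub_self,
      pow_one, pow_zero, one_mul, zero_add, Nat.reduceAdd] at c0 c1
    have hi := h.sheetDeriv_mul_inverse i
    generalize Ring.inverse (W.sheetDeriv P i) = q' at *
    generalize W.sheetDeriv P i = q at *
    generalize W.slope i = p at *
    have e1 : (b₀ * p + b₁) * q' = b₀ * (p * q') + b₁ * q' := by ring
    have e2 : p * (b₀ * (p * q') + b₁ * q') = b₀ * (p ^ 2 * q') + b₁ * (p * q') := by ring
    rw [e1, e2, map_add, map_add, dx.leibniz b₀, dx.leibniz b₁, dy.leibniz b₀, dy.leibniz b₁]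
    simp only [smul_eq_mul]
    linear_combination b₀ * c0 + b₁ * c1 + (p * dx b₀ + dx b₁ + p ^ 2 * dy b₀ + p * dy b₁) * hi
  constructor
  · rintro ⟨h0, h1, h2⟩ i
    have k := key i
    rw [h0, h1, h2, mul_zero, mul_zero, add_zero, add_zero] at k
    exact (mul_eq_zero.1 k).resolve_left (h.isUnit_sheetDeriv i).ne_zero
  · intro hz
    have k0 := key 0
    have k1 := key 1
    have k2 := key 2
    rw [hz, mul_zero] at k0 k1 k2
    have n01 := (h.isUnit_slope_sub (i := 0) (j := 1) (by decide)).ne_zero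
    have n02 := (h.isUnit_slope_sub (i := 0) (j := 2) (by decide)).ne_zero
    have n12 := (h.isUnit_slope_sub (i := 1) (j := 2) (by decide)).ne_zero
    have l2 : dy b₀ + (A 2 0 * b₀ + A 2 1 * b₁) = 0 := by
      refine (mul_eq_zero.1 ?_).resolve_left (mul_ne_zero (mul_ne_zero n01 n02) n12)
      linear_combination -(W.slope 1 - W.slope 2) * k0 + (W.slope 0 - W.slope 2) * k1 -
        (W.slope 0 - W.slope 1) * k2
    have l1 : dx b₀ + dy b₁ + (A 1 0 * b₀ + A 1 1 * b₁) = 0 := by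
      refine (mul_eq_zero.1 ?_).resolve_left n01
      linear_combination -k0 + k1 - (W.slope 0 ^ 2 - W.slope 1 ^ 2) * l2
    refine ⟨?_, l1, l2⟩
    linear_combination -k0 - W.slope 0 * l1 - W.slope 0 ^ 2 * l2

/-- Uses `dFᵢ = ∂_y Fᵢ (dy - pᵢ dx)`, the bridge between relations and forms on the sheets. -/
theorem dForm_eq (G : Hol) (i : Fin 4) :
    dForm (G • dFun (W.F i)) = dx (G * dy (W.F i)) + dy (W.slope i * (G * dy (W.F i))) := by
  have : W.slope i * (G * dy (W.F i)) = -(G * dx (W.F i)) := by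
    linear_combination G * h.dy_mul_slope i
  rw [this, map_neg]
  simp only [dForm, dFun, Prod.smul_mk, smul_eq_mul]
  ring

/-- The pair is fitted to sheets `0` and `1`. By Euler's identities the fitted forms also sum to
zero, so the errors on sheets `2` and `3` satisfy a homogeneous system with determinant `± (p₂ -
p₃)` and vanish. -/
theorem exists_isSolution {G : Fin 4 → Hol} (hG : G ∈ W.abelianRelations) :
    ∃ b₀ b₁, IsSolution (W.systemCoeff P) b₀ b₁ ∧ ∀ i, G i * dy (W.F i) =
      (b₀ * W.slope i + b₁) * Ring.inverse (W.sheetDeriv P i) := by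
  have hx := congrArg Prod.fst hG.2
  have hy := congrArg Prod.snd hG.2
  simp only [Prod.fst_add, Prod.snd_add, Prod.smul_fst, Prod.smul_snd, smul_eq_mul, dFun,
    Prod.fst_zero, Prod.snd_zero, Fin.sum_univ_four] at hx hy
  have k0 := h.sum_slope_pow_mul_inverse 0 (by norm_num)
  have k1 := h.sum_slope_pow_mul_inverse 1 (by norm_num)
  have k2 := h.sum_slope_pow_mul_inverse 2 (by norm_num)
  simp only [Fin.sum_univ_four] at k0 k1 k2
  obtain ⟨e, he⟩ := (h.isUnit_slope_sub (i := 0) (j := 1) (by decide)).exists_right_inv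
  have i0 := h.sheetDeriv_mul_inverse 0
  have i1 := h.sheetDeriv_mul_inverse 1
  have n23 := (h.isUnit_slope_sub (i := 2) (j := 3) (by decide)).ne_zero
  have s0 := h.dy_mul_slope 0
  have s1 := h.dy_mul_slope 1
  have s2 := h.dy_mul_slope 2
  have s3 := h.dy_mul_slope 3
  obtain ⟨b₀, hb₀⟩ : ∃ b₀, b₀ = e * (W.sheetDeriv P 0 * (G 0 * dy (W.F 0)) -
    W.sheetDeriv P 1 * (G 1 * dy (W.F 1))) := ⟨_, rfl⟩
  obtain ⟨b₁, hb₁⟩ : ∃ b₁, b₁ = W.sheetDeriv P 0 * (G 0 * dy (W.F 0)) - b₀ * W.slope 0 := ⟨_, rfl⟩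
  have r0 : G 0 * dy (W.F 0) = (b₀ * W.slope 0 + b₁) * Ring.inverse (W.sheetDeriv P 0) := by
    rw [hb₁]
    linear_combination -(G 0 * dy (W.F 0)) * i0
  have r1 : G 1 * dy (W.F 1) = (b₀ * W.slope 1 + b₁) * Ring.inverse (W.sheetDeriv P 1) := by
    have : b₀ * W.slope 1 + b₁ = W.sheetDeriv P 1 * (G 1 * dy (W.F 1)) := by
      rw [hb₁, hb₀]
      linear_combination -(W.sheetDeriv P 0 * (G 0 * dy (W.F 0)) -
        W.sheetDeriv P 1 * (G 1 * dy (W.F 1))) * he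
    rw [this]
    linear_combination -(G 1 * dy (W.F 1)) * i1
  have m0 : (G 2 * dy (W.F 2) - (b₀ * W.slope 2 + b₁) * Ring.inverse (W.sheetDeriv P 2)) +
      (G 3 * dy (W.F 3) - (b₀ * W.slope 3 + b₁) * Ring.inverse (W.sheetDeriv P 3)) = 0 := by
    linear_combination hy - r0 - r1 - b₁ * k0 - b₀ * k1
  have m1 : W.slope 2 * (G 2 * dy (W.F 2) -
        (b₀ * W.slope 2 + b₁) * Ring.inverse (W.sheetDeriv P 2)) +
      W.slope 3 * (G 3 * dy (W.F 3) -
        (b₀ * W.slope 3 + b₁) * Ring.inverse (W.sheetDeriv P 3)) = 0 := by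
    linear_combination -hx - W.slope 0 * r0 - W.slope 1 * r1 - b₁ * k1 - b₀ * k2 +
      G 0 * s0 + G 1 * s1 + G 2 * s2 + G 3 * s3
  have r2 : G 2 * dy (W.F 2) = (b₀ * W.slope 2 + b₁) * Ring.inverse (W.sheetDeriv P 2) := by
    refine sub_eq_zero.1 ((mul_eq_zero.1 ?_).resolve_left n23)
    linear_combination m1 - W.slope 3 * m0
  have r3 : G 3 * dy (W.F 3) = (b₀ * W.slope 3 + b₁) * Ring.inverse (W.sheetDeriv P 3) := by
    linear_combination m0 - r2
  have hr : ∀ i, G i * dy (W.F i) = (b₀ * W.slope i + b₁) * Ring.inverse (W.sheetDeriv P i) := by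
    intro i
    fin_cases i
    exacts [r0, r1, r2, r3]
  refine ⟨b₀, b₁, (h.isSolution_iff _ _).2 fun i => ?_, hr⟩
  rw [← hr, ← h.dForm_eq, dForm_smul_dFun, Web.wedge_eq_zero hG]

/-- The sum relation is Euler's identities for `k < 3`; closedness gives the dependence on `Fᵢ`
alone through `exists_map_eq`. -/
theorem exists_abelianRelation {b₀ b₁ : Hol} (hb : IsSolution (W.systemCoeff P) b₀ b₁) :
    ∃ G ∈ W.abelianRelations, ∀ i, G i * dy (W.F i) =
      (b₀ * W.slope i + b₁) * Ring.inverse (W.sheetDeriv P i) := by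
  have hy : ∀ i, Ring.inverse (dy (W.F i)) * dy (W.F i) = 1 := fun i =>
    Ring.inverse_mul_cancel _ (h.isUnit_dy i)
  let G : Fin 4 → Hol := fun i => (b₀ * W.slope i + b₁) * Ring.inverse (W.sheetDeriv P i) *
    Ring.inverse (dy (W.F i))
  have hG : ∀ i, G i * dy (W.F i) =
      (b₀ * W.slope i + b₁) * Ring.inverse (W.sheetDeriv P i) := fun i => by
    simp only [G]
    rw [mul_assoc, hy, mul_one]
  refine ⟨G, ⟨fun i => ?_, ?_⟩, hG⟩
  · refine exists_map_eq (W.F_zero i) (h.isUnit_dy i) ?_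
    rw [← dForm_smul_dFun, h.dForm_eq, hG]
    exact (h.isSolution_iff _ _).1 hb i
  · have k0 := h.sum_slope_pow_mul_inverse 0 (by norm_num)
    have k1 := h.sum_slope_pow_mul_inverse 1 (by norm_num)
    have k2 := h.sum_slope_pow_mul_inverse 2 (by norm_num)
    have hx : ∀ i, G i * dx (W.F i) = -(W.slope i * ((b₀ * W.slope i + b₁) *
        Ring.inverse (W.sheetDeriv P i))) := fun i => by
      rw [← hG]
      linear_combination G i * h.dy_mul_slope i
    ext1
    · simp only [Prod.fst_add, Prod.smul_fst, smul_eq_mul, dFun, Prod.fst_zero, hx,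
        Fin.sum_univ_four] at k1 k2 ⊢
      linear_combination -b₀ * k2 - b₁ * k1
    · simp only [Prod.snd_add, Prod.smul_snd, smul_eq_mul, dFun, Prod.snd_zero, hG,
        Fin.sum_univ_four] at k0 k1 ⊢
      linear_combination b₀ * k1 + b₁ * k0

end Web.IsPresentedBy

/-! ### Horizontal sections -/

variable {A : Fin 3 → Fin 2 → Hol}

/-- The section of `E` given by the 2-jet of a solution. -/
def jetSection (A : Fin 3 → Fin 2 → Hol) (b₀ b₁ : Hol) : bundle A :=
  ⟨jetOf A b₀ b₁ (dx b₀), jetOf_mem A _ _ _⟩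

theorem jetSection_horizontal {b₀ b₁ : Hol} (hb : IsSolution A b₀ b₁) :
    nablaX A (jetSection A b₀ b₁) = 0 ∧ nablaY A (jetSection A b₀ b₁) = 0 := by
  obtain ⟨h0, h1, h2⟩ := hb
  have c0 : dx b₁ = -(A 0 0 * b₀ + A 0 1 * b₁) := by linear_combination h0
  have c1 : dy b₁ = -dx b₀ - (A 1 0 * b₀ + A 1 1 * b₁) := by linear_combination h1
  have c2 : dy b₀ = -(A 2 0 * b₀ + A 2 1 * b₁) := by linear_combination h2
  -- The order-one component of `∇` involves second derivatives, so the system has to be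
  -- differentiated to match the prolonged equations built into `jetOf`.
  have d1x := congrArg dx h1
  have d0y := congrArg dy h0
  have d2x := congrArg dx h2
  have e : dx (dy b₁) = dy (dx b₁) := dx_dy _
  have e' : dx (dy b₀) = dy (dx b₀) := dx_dy _
  simp only [map_add, map_zero, Derivation.leibniz, smul_eq_mul] at d1x d0y d2x
  constructor
  · apply bundle_ext
    · simp [nablaX, jetSection, jetOf]
    · simp only [nablaX, jetSection, jetOf]
      simp
      linear_combination h0
    · simp [nablaX, jetSection, jetOf]
      linear_combination d1x - d0y - e + A 1 1 * (-c0) - A 0 1 * (-c1) - A 0 0 * (-c2)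
  · apply bundle_ext
    · simp [nablaY, jetSection, jetOf]
      linear_combination h2
    · simp [nablaY, jetSection, jetOf]
      linear_combination h1
    · simp [nablaY, jetSection, jetOf]
      linear_combination d2x - e' - A 2 1 * c0

/-- Vanishing of the order-zero components of `∇ s` says that the formal first derivatives in the
jet are true derivatives. -/
theorem isSolution_of_horizontal {s : bundle A} (hx : nablaX A s = 0) (hy : nablaY A s = 0) :
    IsSolution A (s.1 0 .o) (s.1 1 .o) ∧ dx (s.1 0 .o) = s.1 0 .x := by
  obtain ⟨a0, a1, a2, -⟩ := (s.2 : IsFormalSolution A s.1)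
  simp only [eqO, Fin.sum_univ_two] at a0 a1 a2
  have x0 := (nablaX_spec A s 0).1
  have x1 := (nablaX_spec A s 1).1
  have y0 := (nablaY_spec A s 0).1
  have y1 := (nablaY_spec A s 1).1
  rw [hx] at x0 x1
  rw [hy] at y0 y1
  change (0 : Hol) = _ at x0 x1 y0 y1
  refine ⟨⟨?_, ?_, ?_⟩, ?_⟩
  · linear_combination a0 - x1
  · linear_combination a1 - x0 - y1
  · linear_combination a2 - y0
  · linear_combination -x0

/-- In order zero the commutator of `∇ₓ` and `∇_y` involves only jet components of order at most
two, where the mixed terms agree; only the order-one row `∂ₓ b₀` can be nonzero. -/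
theorem curvature_apply_zero (s : bundle A) (l : Fin 2) : (curvature A s).1 l .o = 0 := by
  change (nablaX A (nablaY A s)).1 l .o - (nablaY A (nablaX A s)).1 l .o = 0
  rw [(nablaX_spec A (nablaY A s) l).1, (nablaY_spec A (nablaX A s) l).1,
    (nablaX_spec A s l).1, (nablaY_spec A s l).1,
    (nablaX_spec A s l).2.2, (nablaY_spec A s l).2.1, map_sub, map_sub, dx_dy]
  ring

/-- The basis of `E` given by the components `b₀`, `b₁`, `∂ₓ b₀`. -/
def bundleBasis (A : Fin 3 → Fin 2 → Hol) : Module.Basis (Fin 3) Hol (bundle A) :=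
  Module.Basis.ofEquivFun (bundleEquiv A)

theorem trace_curvature :
    LinearMap.trace Hol (bundle A) (curvature A) =
      (curvature A (bundleBasis A 2)).1 0 .x := by
  rw [LinearMap.trace_eq_matrix_trace Hol (bundleBasis A), Matrix.trace, Fin.sum_univ_three]
  simp only [Matrix.diag_apply, LinearMap.toMatrix_apply]
  change (bundleEquiv A (curvature A (bundleBasis A 0))) 0 +
    (bundleEquiv A (curvature A (bundleBasis A 1))) 1 +
    (bundleEquiv A (curvature A (bundleBasis A 2))) 2 = _
  change (curvature A (bundleBasis A 0)).1 0 .o + (curvature A (bundleBasis A 1)).1 1 .o +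
    (curvature A (bundleBasis A 2)).1 0 .x = _
  rw [curvature_apply_zero, curvature_apply_zero, zero_add, zero_add]

theorem eq_sum_bundleBasis (s : bundle A) :
    s = s.1 0 .o • bundleBasis A 0 + s.1 1 .o • bundleBasis A 1 + s.1 0 .x • bundleBasis A 2 := by
  conv_lhs => rw [← (bundleBasis A).sum_repr s, Fin.sum_univ_three]
  rfl

theorem curvature_eq_zero_of_horizontal {s : bundle A} (hx : nablaX A s = 0)
    (hy : nablaY A s = 0) : curvature A s = 0 := by
  have hX0 : nablaX A 0 = 0 := by simpa using nablaX_add A 0 0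
  have hY0 : nablaY A 0 = 0 := by simpa using nablaY_add A 0 0
  change nablaX A (nablaY A s) - nablaY A (nablaX A s) = 0
  rw [hx, hy, hX0, hY0, sub_zero]

/-- If the trace of the curvature vanishes, two horizontal sections with independent components of
order zero make the connection flat. -/
theorem curvature_eq_zero (htr : LinearMap.trace Hol (bundle A) (curvature A) = 0)
    {s t : bundle A} (hs : curvature A s = 0) (ht : curvature A t = 0)
    (hst : s.1 0 .o * t.1 1 .o - s.1 1 .o * t.1 0 .o ≠ 0) : curvature A = 0 := by
  rw [trace_curvature] at htr
  have h2 : curvature A (bundleBasis A 2) = 0 :=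
    bundle_ext (curvature_apply_zero _ _) (curvature_apply_zero _ _) htr
  have h : ∀ s : bundle A, (curvature A s).1 0 .x =
      s.1 0 .o * (curvature A (bundleBasis A 0)).1 0 .x +
      s.1 1 .o * (curvature A (bundleBasis A 1)).1 0 .x := by
    intro s
    conv_lhs => rw [eq_sum_bundleBasis s, map_add, map_add, map_smul, map_smul, map_smul, h2,
      smul_zero, add_zero]
    rfl
  have es := h s
  have et := h t
  rw [hs] at es
  rw [ht] at et
  change (0 : Hol) = _ at es et
  have k0 : (curvature A (bundleBasis A 0)).1 0 .x = 0 := by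
    refine (mul_eq_zero.1 ?_).resolve_left hst
    linear_combination -t.1 1 .o * es + s.1 1 .o * et
  have k1 : (curvature A (bundleBasis A 1)).1 0 .x = 0 := by
    refine (mul_eq_zero.1 ?_).resolve_left hst
    linear_combination t.1 0 .o * es - s.1 0 .o * et
  refine LinearMap.ext fun r => bundle_ext (curvature_apply_zero _ _) (curvature_apply_zero _ _) ?_
  rw [h, k0, k1, mul_zero, mul_zero, add_zero]
  rfl

/-- A horizontal section that vanishes at the origin is zero. -/
theorem eq_zero_of_horizontal {s : bundle A} (hx : nablaX A s = 0) (hy : nablaY A s = 0)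
    (h0 : (s.1 0 .o).value = 0) (h1 : (s.1 1 .o).value = 0) (h2 : (s.1 0 .x).value = 0) :
    s = 0 := by
  -- For a horizontal section the derivatives of these three components are jet components, hence
  -- linear combinations of the three: `I` is stable under both derivations, and
  -- `Hol.eq_zero_of_mem` applies.
  let I : Ideal Hol := Ideal.span {s.1 0 .o, s.1 1 .o, s.1 0 .x}
  have m0 : s.1 0 .o ∈ I := Ideal.subset_span (by simp)
  have m1 : s.1 1 .o ∈ I := Ideal.subset_span (by simp)
  have m2 : s.1 0 .x ∈ I := Ideal.subset_span (by simp)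
  obtain ⟨a0, a1, a2, -, a4, a5, a6, -⟩ := (s.2 : IsFormalSolution A s.1)
  have hπ : ∀ {φ : Hol}, Ideal.Quotient.mk I φ = 0 ↔ φ ∈ I := Ideal.Quotient.eq_zero_iff_mem
  have q0 := hπ.2 m0
  have q1 := hπ.2 m1
  have q2 := hπ.2 m2
  have x1 : Ideal.Quotient.mk I (s.1 1 .x) = 0 := by
    simpa [eqO, q0, q1] using congrArg (Ideal.Quotient.mk I) a0
  have y1 : Ideal.Quotient.mk I (s.1 1 .y) = 0 := by
    simpa [eqO, q0, q1, q2] using congrArg (Ideal.Quotient.mk I) a1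
  have y0 : Ideal.Quotient.mk I (s.1 0 .y) = 0 := by
    simpa [eqO, q0, q1] using congrArg (Ideal.Quotient.mk I) a2
  have xy0 : Ideal.Quotient.mk I (s.1 0 .xy) = 0 := by
    simpa [eqX, q0, q1, q2, x1] using congrArg (Ideal.Quotient.mk I) a5
  have xy1 : Ideal.Quotient.mk I (s.1 1 .xy) = 0 := by
    simpa [eqY, q0, q1, y0, y1] using congrArg (Ideal.Quotient.mk I) a6
  have xx0 : Ideal.Quotient.mk I (s.1 0 .xx) = 0 := by
    simpa [eqX, q0, q1, q2, x1, xy1] using congrArg (Ideal.Quotient.mk I) a4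
  have hX : ∀ l, dx (s.1 l .o) = s.1 l .x ∧ dx (s.1 l .x) = s.1 l .xx := fun l => by
    have := nablaX_spec A s l
    rw [hx] at this
    exact ⟨(sub_eq_zero.1 this.1.symm), (sub_eq_zero.1 this.2.1.symm)⟩
  have hY : ∀ l, dy (s.1 l .o) = s.1 l .y ∧ dy (s.1 l .x) = s.1 l .xy := fun l => by
    have := nablaY_spec A s l
    rw [hy] at this
    exact ⟨(sub_eq_zero.1 this.1.symm), (sub_eq_zero.1 this.2.1.symm)⟩
  have hstable : ∀ D : Derivation ℂ Hol Hol, D (s.1 0 .o) ∈ I → D (s.1 1 .o) ∈ I →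
      D (s.1 0 .x) ∈ I → ∀ φ ∈ I, D φ ∈ I := by
    intro D h0 h1 h2 φ hφ
    refine Submodule.span_induction (p := fun φ _ => D φ ∈ I) ?_ ?_ ?_ ?_ hφ
    · rintro x (rfl | rfl | rfl)
      exacts [h0, h1, h2]
    · rw [map_zero]; exact I.zero_mem
    · intro x y _ _ hx hy
      rw [map_add]; exact I.add_mem hx hy
    · intro a x hx hDx
      rw [smul_eq_mul, D.leibniz]
      exact I.add_mem (I.mul_mem_left _ hDx) (I.mul_mem_right _ hx)
  have hIx := hstable dx (by rw [(hX 0).1]; exact m2) (by rw [(hX 1).1]; exact hπ.1 x1)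
    (by rw [(hX 0).2]; exact hπ.1 xx0)
  have hIy := hstable dy (by rw [(hY 0).1]; exact hπ.1 y0) (by rw [(hY 1).1]; exact hπ.1 y1)
    (by rw [(hY 0).2]; exact hπ.1 xy0)
  have hle : I ≤ RingHom.ker Hol.eval₀ := Ideal.span_le.2 (by
    rintro x (rfl | rfl | rfl)
    exacts [h0, h1, h2])
  have hval : ∀ φ ∈ I, φ.value = 0 := fun φ hφ => hle hφ
  exact bundle_ext (Hol.eq_zero_of_mem hIx hIy hval m0) (Hol.eq_zero_of_mem hIx hIy hval m1)
    (Hol.eq_zero_of_mem hIx hIy hval m2)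

/-- A flat connection with two horizontal sections that are part of a basis has a horizontal section
that completes them to a basis. -/
theorem exists_horizontal_section (hflat : curvature A = 0) {s t c : bundle A}
    (hsx : nablaX A s = 0) (hsy : nablaY A s = 0) (htx : nablaX A t = 0) (hty : nablaY A t = 0)
    (hspan : ∀ r : bundle A, ∃ a b f : Hol, r = a • s + b • t + f • c)
    (hind : ∀ a b f : Hol, a • s + b • t + f • c = 0 → a = 0 ∧ b = 0 ∧ f = 0) :
    ∃ a b f : Hol, IsUnit f ∧ nablaX A (a • s + b • t + f • c) = 0 ∧
      nablaY A (a • s + b • t + f • c) = 0 := by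
  obtain ⟨a₁, a₂, a₃, hcx⟩ := hspan (nablaX A c)
  obtain ⟨b₁, b₂, b₃, hcy⟩ := hspan (nablaY A c)
  have hX : ∀ a b f : Hol, nablaX A (a • s + b • t + f • c) =
      (dx a + f * a₁) • s + (dx b + f * a₂) • t + (dx f + f * a₃) • c := by
    intro a b f
    rw [nablaX_add, nablaX_add, nablaX_smul, nablaX_smul, nablaX_smul, hsx, htx, hcx]
    module
  have hY : ∀ a b f : Hol, nablaY A (a • s + b • t + f • c) =
      (dy a + f * b₁) • s + (dy b + f * b₂) • t + (dy f + f * b₃) • c := by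
    intro a b f
    rw [nablaY_add, nablaY_add, nablaY_smul, nablaY_smul, nablaY_smul, hsy, hty, hcy]
    module
  have hc : nablaX A (nablaY A c) - nablaY A (nablaX A c) = 0 := LinearMap.congr_fun hflat c
  rw [hcx, hcy, hX, hY] at hc
  -- Flatness on `c`, read in the basis: `e₃` says that `(a₃, b₃)` is closed, and `e₁`, `e₂` make `f
  -- (a₁, b₁)` and `f (a₂, b₂)` closed once `d log f = -(a₃, b₃)`.
  obtain ⟨e₁, e₂, e₃⟩ := hind (dx b₁ + b₃ * a₁ - (dy a₁ + a₃ * b₁))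
    (dx b₂ + b₃ * a₂ - (dy a₂ + a₃ * b₂)) (dx b₃ + b₃ * a₃ - (dy a₃ + a₃ * b₃)) (by
      rw [← hc]
      module)
  obtain ⟨φ, hφx, hφy⟩ := Hol.exists_primitive (a := -a₃) (b := -b₃) (by
    rw [map_neg, map_neg]
    linear_combination -e₃)
  obtain ⟨f, hf, hfx, hfy⟩ := Hol.exists_exp φ
  rw [hφx] at hfx
  rw [hφy] at hfy
  obtain ⟨g₁, h1x, h1y⟩ := Hol.exists_primitive (a := -(f * a₁)) (b := -(f * b₁)) (by
    rw [map_neg, map_neg, dx.leibniz, dy.leibniz, hfx, hfy]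
    simp only [smul_eq_mul]
    linear_combination -f * e₁)
  obtain ⟨g₂, h2x, h2y⟩ := Hol.exists_primitive (a := -(f * a₂)) (b := -(f * b₂)) (by
    rw [map_neg, map_neg, dx.leibniz, dy.leibniz, hfx, hfy]
    simp only [smul_eq_mul]
    linear_combination -f * e₂)
  refine ⟨g₁, g₂, f, hf, ?_, ?_⟩
  · rw [hX, h1x, h2x, hfx]
    module
  · rw [hY, h1y, h2y, hfy]
    module

theorem dx_const (α : ℂ) : dx (Hol.const α) = 0 := dx.map_algebraMap α

theorem dy_const (α : ℂ) : dy (Hol.const α) = 0 := dy.map_algebraMap α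

open scoped Matrix in
/-- Two independent horizontal sections are part of a basis of `E`. -/
theorem exists_basis_extension {s t : bundle A}
    (hsx : nablaX A s = 0) (hsy : nablaY A s = 0) (htx : nablaX A t = 0) (hty : nablaY A t = 0)
    (hst : ∀ α β : ℂ, Hol.const α • s + Hol.const β • t = 0 → α = 0 ∧ β = 0) :
    ∃ c : bundle A, (∀ r : bundle A, ∃ a b f : Hol, r = a • s + b • t + f • c) ∧
      ∀ a b f : Hol, a • s + b • t + f • c = 0 → a = 0 ∧ b = 0 ∧ f = 0 := by
  let v : bundle A → Fin 3 → ℂ := fun s i => (bundleEquiv A s i).value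
  -- A constant combination of `s` and `t` is horizontal, so it is zero as soon as its value at the
  -- origin is.
  have hv : LinearIndependent ℂ ![v s, v t] := by
    rw [LinearIndependent.pair_iff]
    intro α β hαβ
    refine hst α β (eq_zero_of_horizontal ?_ ?_ ?_ ?_ ?_)
    · rw [nablaX_add, nablaX_smul, nablaX_smul, hsx, htx, dx_const, dx_const]
      module
    · rw [nablaY_add, nablaY_smul, nablaY_smul, hsy, hty, dy_const, dy_const]
      module
    · have := congrFun hαβ 0
      rw [← Hol.eval₀_apply]
      change Hol.eval₀ (Hol.const α * _ + Hol.const β * _) = 0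
      rw [map_add, map_mul, map_mul]
      exact this
    · have := congrFun hαβ 1
      rw [← Hol.eval₀_apply]
      change Hol.eval₀ (Hol.const α * _ + Hol.const β * _) = 0
      rw [map_add, map_mul, map_mul]
      exact this
    · have := congrFun hαβ 2
      rw [← Hol.eval₀_apply]
      change Hol.eval₀ (Hol.const α * _ + Hol.const β * _) = 0
      rw [map_add, map_mul, map_mul]
      exact this
  -- A nonzero coordinate `k` of the cross product of the values is the determinant at the origin of
  -- `s`, `t` and the `k`-th basis vector; hence that determinant is a unit of `𝒪`.
  have hcross := crossProduct_ne_zero_iff_linearIndependent.2 hv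
  obtain ⟨k, hk⟩ := Function.ne_iff.1 hcross
  rw [Pi.zero_apply] at hk
  let M : Matrix (Fin 3) (Fin 3) Hol :=
    Matrix.of ![bundleEquiv A s, bundleEquiv A t, Pi.single k 1]
  have hM : IsUnit M := by
    rw [Matrix.isUnit_iff_isUnit_det, Hol.isUnit_iff]
    convert hk using 1
    rw [← Hol.eval₀_apply, Matrix.det_fin_three, cross_apply]
    simp only [M, v, Matrix.of_apply, Matrix.cons_val_zero, Matrix.cons_val_one, Matrix.cons_val,
      ← Hol.eval₀_apply, map_add, map_sub, map_mul]
    fin_cases k <;> simp <;> ring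
  have hMv : ∀ x : Fin 3 → Hol, x ᵥ* M = x 0 • bundleEquiv A s + x 1 • bundleEquiv A t +
      x 2 • (Pi.single k 1 : Fin 3 → Hol) := by
    intro x
    rw [Matrix.vecMul_eq_sum, Fin.sum_univ_three]
    rfl
  have he : ∀ a b f : Hol, bundleEquiv A (a • s + b • t +
      f • (bundleEquiv A).symm (Pi.single k 1)) = ![a, b, f] ᵥ* M := by
    intro a b f
    rw [hMv, map_add, map_add, map_smul, map_smul, map_smul, LinearEquiv.apply_symm_apply]
    rfl
  refine ⟨(bundleEquiv A).symm (Pi.single k 1), fun r => ?_, fun a b f h => ?_⟩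
  · obtain ⟨x, hx⟩ := Matrix.vecMul_surjective_iff_isUnit.2 hM (bundleEquiv A r)
    refine ⟨x 0, x 1, x 2, (bundleEquiv A).injective ?_⟩
    rw [he, ← hx]
    congr 1
    ext i
    fin_cases i <;> rfl
  · have h1 := he a b f
    rw [h, map_zero] at h1
    have h2 : ![a, b, f] = 0 := Matrix.vecMul_injective_of_isUnit hM (by
      change _ ᵥ* M = 0 ᵥ* M
      rw [← h1, Matrix.zero_vecMul])
    exact ⟨congrFun h2 0, congrFun h2 1, congrFun h2 2⟩

/-! ### Webs of rank two -/

theorem Web.rank_ne_two_of_blaschkeChern (W : Web 4) {P : Hol[X]} (h : W.IsPresentedBy P)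
    (hP : W.blaschkeChern P = 0) : W.rank ≠ 2 := by
  intro hrank
  set A := W.systemCoeff P with hA
  obtain ⟨v, hv⟩ := Module.le_rank_iff.1 (show ((2 : ℕ) : Cardinal) ≤ W.rank by
    rw [hrank]; norm_num)
  rw [Fintype.linearIndependent_iff] at hv
  have hG := (v 0).2
  have hH := (v 1).2
  have hv' : ∀ α β : ℂ, α • (v 0).1 + β • (v 1).1 = 0 → α = 0 ∧ β = 0 := by
    intro α β hαβ
    have := hv ![α, β] (by
      rw [Fin.sum_univ_two]
      exact Subtype.ext hαβ)
    exact ⟨this 0, this 1⟩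
  generalize (v 0).1 = G at hG hv'
  generalize (v 1).1 = H at hH hv'
  obtain ⟨b₀, b₁, hb, hGb⟩ := h.exists_isSolution hG
  obtain ⟨c₀, c₁, hc, hHc⟩ := h.exists_isSolution hH
  obtain ⟨hsx, hsy⟩ := jetSection_horizontal hb
  obtain ⟨htx, hty⟩ := jetSection_horizontal hc
  have hdy : ∀ i, dy (W.F i) ≠ 0 := fun i => (h.isUnit_dy i).ne_zero
  have hst : ∀ α β : ℂ, Hol.const α • jetSection A b₀ b₁ + Hol.const β • jetSection A c₀ c₁ = 0 →
      α = 0 ∧ β = 0 := by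
    intro α β hαβ
    have e0 : Hol.const α * b₀ + Hol.const β * c₀ = 0 :=
      congrArg (fun s : bundle A => s.1 0 .o) hαβ
    have e1 : Hol.const α * b₁ + Hol.const β * c₁ = 0 :=
      congrArg (fun s : bundle A => s.1 1 .o) hαβ
    refine hv' α β (funext fun i => (mul_eq_zero.1 ?_).resolve_right (hdy i))
    change (Hol.const α * G i + Hol.const β * H i) * dy (W.F i) = 0
    linear_combination Hol.const α * hGb i + Hol.const β * hHc i +
      (W.slope i * e0 + e1) * Ring.inverse (W.sheetDeriv P i)
  -- The 2×2 minors of the two relations are multiples of this determinant, by factors `(pᵢ - pⱼ) /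
  -- (qᵢ qⱼ)` up to the units `∂_y F`; if it vanished, the relations would be proportional over `ℂ`.
  have hδ : b₀ * c₁ - b₁ * c₀ ≠ 0 := by
    intro hδ
    have hH0 : H ≠ 0 := by
      rintro rfl
      exact one_ne_zero (hv' 0 1 (by simp)).2
    obtain ⟨c, hc⟩ := Web.exists_smul_eq (by norm_num) hG hH hH0 fun i j => by
      refine sub_eq_zero.1 ((mul_eq_zero.1 ?_).resolve_right (mul_ne_zero (hdy i) (hdy j)))
      have : (G i * H j - G j * H i) * (dy (W.F i) * dy (W.F j)) =
          (G i * dy (W.F i)) * (H j * dy (W.F j)) - (G j * dy (W.F j)) * (H i * dy (W.F i)) := by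
        ring
      rw [this, hGb, hGb, hHc, hHc]
      linear_combination Ring.inverse (W.sheetDeriv P i) * Ring.inverse (W.sheetDeriv P j) *
        (W.slope i - W.slope j) * hδ
    exact one_ne_zero (hv' 1 (-c) (by rw [hc]; module)).1
  have hflat := curvature_eq_zero hP (curvature_eq_zero_of_horizontal hsx hsy)
    (curvature_eq_zero_of_horizontal htx hty) hδ
  obtain ⟨c, hspan, hind⟩ := exists_basis_extension hsx hsy htx hty hst
  obtain ⟨a, b, f, hf, hrx, hry⟩ := exists_horizontal_section hflat hsx hsy htx hty hspan hind
  obtain ⟨r, hr⟩ : ∃ r, r = a • jetSection A b₀ b₁ + b • jetSection A c₀ c₁ + f • c := ⟨_, rfl⟩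
  rw [← hr] at hrx hry
  obtain ⟨hsol, hr0⟩ := isSolution_of_horizontal hrx hry
  obtain ⟨K, hK, hKr⟩ := h.exists_abelianRelation hsol
  have hthree : ((3 : ℕ) : Cardinal) ≤ W.rank := by
    refine Module.le_rank_iff.2 ⟨![⟨G, hG⟩, ⟨H, hH⟩, ⟨K, hK⟩], ?_⟩
    rw [Fintype.linearIndependent_iff]
    intro g hg
    rw [Fin.sum_univ_three] at hg
    have hg' : ∀ i, Hol.const (g 0) * G i + Hol.const (g 1) * H i + Hol.const (g 2) * K i = 0 :=
      fun i => congrFun (congrArg Subtype.val hg) i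
    obtain ⟨B₀, hB₀⟩ : ∃ B, B = Hol.const (g 0) * b₀ + Hol.const (g 1) * c₀ +
      Hol.const (g 2) * r.1 0 .o := ⟨_, rfl⟩
    obtain ⟨B₁, hB₁⟩ : ∃ B, B = Hol.const (g 0) * b₁ + Hol.const (g 1) * c₁ +
      Hol.const (g 2) * r.1 1 .o := ⟨_, rfl⟩
    -- A linear dependence of the three relations is a solution with zero forms on every sheet: `B₀
    -- p + B₁` vanishes at distinct slopes, and the dependence lifts to the sections.
    have hB : ∀ i, B₀ * W.slope i + B₁ = 0 := by
      intro i
      have hq := (IsUnit.of_mul_eq_one_right _ (h.sheetDeriv_mul_inverse i)).ne_zero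
      refine (mul_eq_zero.1 ?_).resolve_right hq
      rw [hB₀, hB₁]
      linear_combination dy (W.F i) * hg' i - Hol.const (g 0) * hGb i - Hol.const (g 1) * hHc i -
        Hol.const (g 2) * hKr i
    have hB0 : B₀ = 0 := by
      refine (mul_eq_zero.1 ?_).resolve_right
        (h.isUnit_slope_sub (i := 0) (j := 1) (by decide)).ne_zero
      linear_combination hB 0 - hB 1
    have hB1 : B₁ = 0 := by simpa [hB0] using hB 0
    have hsec : Hol.const (g 0) • jetSection A b₀ b₁ + Hol.const (g 1) • jetSection A c₀ c₁ +
        Hol.const (g 2) • r = 0 := by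
      refine bundle_ext (hB₀.symm.trans hB0) (hB₁.symm.trans hB1) ?_
      change Hol.const (g 0) * dx b₀ + Hol.const (g 1) * dx c₀ + Hol.const (g 2) * r.1 0 .x = 0
      have := congrArg dx (hB₀.symm.trans hB0)
      simp only [map_add, Derivation.leibniz, dx_const, smul_eq_mul, mul_zero, add_zero, map_zero,
        hr0] at this
      exact this
    -- The coefficient of `c` is `g 2` times the unit `f`, so `g 2 = 0`, and the other two constants
    -- follow.
    obtain ⟨k0, k1, k2⟩ := hind (Hol.const (g 0) + Hol.const (g 2) * a)
      (Hol.const (g 1) + Hol.const (g 2) * b) (Hol.const (g 2) * f) (by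
        rw [← hsec, hr]
        module)
    have hconst : ∀ α, Hol.const α = 0 → α = 0 := fun α hα =>
      Hol.const.injective (hα.trans (map_zero _).symm)
    have g2 := (mul_eq_zero.1 k2).resolve_right hf.ne_zero
    rw [g2, zero_mul, add_zero] at k0 k1
    intro i
    fin_cases i
    exacts [hconst _ k0, hconst _ k1, hconst _ g2]
  rw [hrank] at hthree
  norm_num at hthree

end PlaneWeb

end

theorem mainTheorem7 (W : PlaneWeb.Web 4) :
    ((∃ K : PlaneWeb.Hol, K ≠ 0 ∧ ∀ k : Fin 4, (W.extract k).IsBlaschkeCurvature K) →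
      W.rank ≤ 1) ∧
    (∀ P : Polynomial PlaneWeb.Hol, W.IsPresentedBy P → W.blaschkeChern P = 0 → W.rank ≠ 2) := by
  exact ⟨fun ⟨_, hK, h⟩ => W.rank_le_one_of_curvature hK h,
    fun _ hP h => W.rank_ne_two_of_blaschkeChern hP h⟩
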